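/- **Setting.** Let $\mathcal Q$ be an arbitrary CSS code (in particular any LDPC one) with check matrices $H_X,H_Z$ over $\mathbb F_2$, $H_XH_Z^\top=0$, and $k$ logical qubits with a complete set of logical operators $\bar X^{(i)}$ ($X$-type) and $\bar Z^{(i)}$ ($Z$-type), $1\le i\le k$. Let $c\ne t$ be two logical qubits such that the supports $\mathcal L_Z$ of $\bar Z^{(c)}$ and $\mathcal L_X$ of $\bar X^{(t)}$ are disjoint. Let $m\ge1$; layers and positions are indexed by $\mathbb Z/m$. Let $C$ be the cyclic shift, $e_jC=e_{j+1}$ on row vectors, and $H_C=I+C$. The toric code has qubit sets $\mathcal Q^Z_i,\mathcal Q^X_i$ of $m$ qubits each; the $X$-checks $\mathcal C^X_i$ act by $H_C$ on $\mathcal Q^Z_i$ and by $I$ on $\mathcal Q^X_i$ and $\mathcal Q^X_{i-1}$; the $Z$-checks $\mathcal C^Z_i$ act by $H_C^\top$ on $\mathcal Q^X_i$ and by $I$ on $\mathcal Q^Z_i$ and $\mathcal Q^Z_{i+1}$. Put $\bar X^{(1)}_{\rm tor}=\prod_i X(e_0\in\mathcal Q^Z_i)$ and $\bar Z^{(2)}_{\rm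 tor}=\prod_i Z(e_0\in\mathcal Q^X_i)$. Let $\mathcal G_Z,\mathcal G_X$ be finite connected graphs with edge–vertex incidence matrices $G_Z,G_X$, with injective port maps $\mathcal L_Z\to\mathcal V_Z$, $\mathcal L_X\to\mathcal V_X$ (with 0/1 matrices $F_Z,F_X$), with matrices $N_Z,N_X$ whose rows span the cycle spaces, with matching matrices satisfying $M_ZG_Z=H_X|_{\mathcal L_Z}F_Z$ and $M_XG_X=H_Z|_{\mathcal L_X}F_X$, and with adapter matrices satisfying $T_ZG_Z=H_CP_Z^\top$ and $T_XG_X=H_C^\top P_X^\top$, where $P_Z,P_X$ are the 0/1 matrices of injective labellings of vertices by $\mathbb Z/m$ (rows indexed by vertices, columns by labels). The *merged code* has as qubits those of $\mathcal Q$, one qubit for each edge in $\mathcal E_Z\cup\mathcal E_X$, and those of the toric code. Its $X$-checks are: the $X$-checks of $\mathcal Q$ extended by $M_Z$ to $\mathcal E_Z$; the cycles $N_Z$ on $\mathcal E_Z$; the sets $\mathcal C^X_i$, where $\mathcal C^X_0$ is extended by $T_Z$ to $\mathcal E_Z$; and one check per vertex of $\mathcal G_X$, acting on its incident edge qubits,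 on the qubit of $\mathcal L_X$ mapped to it (if any), and on the qubit of $\mathcal Q^X_{m-1}$ whose label it carries (if any). Its $Z$-checks are: the $Z$-checks of $\mathcal Q$ extended by $M_X$ to $\mathcal E_X$; the cycles $N_X$ on $\mathcal E_X$; the sets $\mathcal C^Z_i$, where $\mathcal C^Z_{m-1}$ is extended by $T_X$ to $\mathcal E_X$; and one check per vertex of $\mathcal G_Z$, acting on its incident edge qubits, on the qubit of $\mathcal L_Z$ mapped to it (if any), and on the qubit of $\mathcal Q^Z_0$ whose label it carries (if any). A *merged representative* of a logical operator $\bar X^{(i)}$ (resp. $\bar Z^{(i)}$) of $\mathcal Q$ is an $X$-type (resp. $Z$-type) operator that commutes with all checks of the merged code and is the product of $\bar X^{(i)}$ (resp. $\bar Z^{(i)}$) with same-type stabilizers of the system before merging, i.e. of $\mathcal Q$ together with $|+\rangle$ on $\mathcal E_Z$, $|0\rangle$ on $\mathcal E_X$ and the toric code in the state stabilized by $\bar X^{(1)}_{\rm tor}$ and $\bar Z^{(2)}_{\rm tor}$. **Theorem.** Every $\bar X^{(i)}$ and every $\bar Z^{(i)}$ has a merged representative, and any choice of merged representatives (again written $\bar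 X^{(i)},\bar Z^{(i)}$) is a complete set of logical operators of the $k$ logical qubits of the merged code. The circuit $$U=\prod_{i=0}^{m-1}\Gamma'_i(\mathcal Q^Z_i)\,\Gamma_i(\mathcal Q^X_i)\,\mathrm{CNOT}(\mathcal Q^Z_i,\mathcal Q^X_i),$$ where $\mathrm{CNOT}(\mathcal Q^Z_i,\mathcal Q^X_i)=\prod_j\mathrm{CNOT}_{a_jb_j}$ is the transversal gate from the $j$-th qubit $a_j$ of $\mathcal Q^Z_i$ to the $j$-th qubit $b_j$ of $\mathcal Q^X_i$, $\Gamma'_i$ permutes the qubits of the set by $C^{-i}$ ($e_j\mapsto e_{j-i}$) and $\Gamma_i$ permutes them by $C^{-i-1}$ ($e_j\mapsto e_{j-i-1}$), implements the logical $\overline{\mathrm{CNOT}}_{ct}$ on the merged code: $U$ is unitary and normalizes the stabilizer group; modulo stabilizers, conjugation by $U$ maps $\bar X^{(c)}\mapsto\bar X^{(c)}\bar X^{(t)}$, $\bar Z^{(t)}\mapsto\bar Z^{(c)}\bar Z^{(t)}$, and fixes $\bar X^{(i)}$ for $i\ne c$ and $\bar Z^{(i)}$ for $i\ne t$; and on the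 code space $U$ equals $\tfrac12(1+\bar Z^{(c)})+\tfrac12(1-\bar Z^{(c)})\bar X^{(t)}$. -/

import Mathlib

namespace ToricAdapter

open Matrix

/-! ### Qubits, Pauli operators and gates -/

section Gates

variable {Q : Type*} [Fintype Q] [DecidableEq Q]

/-- The Pauli operator `X(u)`: it maps the computational basis state `|s⟩` to `|s + u⟩`. -/
def xOp (u : Q → ZMod 2) : Matrix (Q → ZMod 2) (Q → ZMod 2) ℂ :=
  Matrix.of fun s' s => if s' = s + u then 1 else 0

/-- The Pauli operator `Z(v)`: it maps `|s⟩` to `(-1)^(v · s) |s⟩`. -/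
def zOp (v : Q → ZMod 2) : Matrix (Q → ZMod 2) (Q → ZMod 2) ℂ :=
  Matrix.diagonal fun s => if v ⬝ᵥ s = 0 then 1 else -1

/-- The physical CNOT gate with control `a` and target `b`. -/
def cnotGate (a b : Q) : Matrix (Q → ZMod 2) (Q → ZMod 2) ℂ :=
  Matrix.of fun s' s => if s' = Function.update s b (s b + s a) then 1 else 0

/-- The unitary that permutes the qubits by `p`: the content of qubit `q` is moved to qubit `p q`,
so that it conjugates `X(e_q)` to `X(e_{p q})` and `Z(e_q)` to `Z(e_{p q})`. -/
def permGate (p : Equiv.Perm Q) : Matrix (Q → ZMod 2) (Q → ZMod 2) ℂ :=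
  Matrix.of fun s' s => if s' = s ∘ p.symm then 1 else 0

end Gates

/-! ### CSS codes -/

/-- A CSS code with qubit set `Q`, given by an `X`-check matrix (rows indexed by `SX`) and a
`Z`-check matrix (rows indexed by `SZ`) whose checks commute. -/
structure CSSCode (SX SZ Q : Type*) [Fintype Q] where
  HX : Matrix SX Q (ZMod 2)
  HZ : Matrix SZ Q (ZMod 2)
  comm : HX * HZᵀ = 0

namespace CSSCode

variable {SX SZ Q ι : Type*} [Fintype Q] [DecidableEq Q] [DecidableEq ι]

/-- `(LX i, LZ i)`, `i : ι`, are the supports of a complete set of logical Pauli operators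
`X̄^(i)`, `Z̄^(i)` of the code: they commute with all checks, satisfy the Pauli commutation relations,
and together with the checks they generate all logical operators. -/
structure IsLogicalBasis (C : CSSCode SX SZ Q) (LX LZ : ι → Q → ZMod 2) : Prop where
  x_comm : ∀ i, C.HZ *ᵥ LX i = 0
  z_comm : ∀ i, C.HX *ᵥ LZ i = 0
  pairing : ∀ i j, LX i ⬝ᵥ LZ j = if i = j then 1 else 0
  x_complete : ∀ x, C.HZ *ᵥ x = 0 →
    x ∈ Submodule.span (ZMod 2) (Set.range C.HX) ⊔ Submodule.span (ZMod 2) (Set.range LX)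
  z_complete : ∀ z, C.HX *ᵥ z = 0 →
    z ∈ Submodule.span (ZMod 2) (Set.range C.HZ) ⊔ Submodule.span (ZMod 2) (Set.range LZ)

/-- The stabilizer group, generated by the checks (which are involutions, so that the monoid they
generate is a group). -/
def stabilizer (C : CSSCode SX SZ Q) : Submonoid (Matrix (Q → ZMod 2) (Q → ZMod 2) ℂ) :=
  Submonoid.closure
    (Set.range (fun s => xOp (C.HX s)) ∪ Set.range (fun s => zOp (C.HZ s)))

/-- The code space: the joint `+1` eigenspace of all stabilizers. -/
def codeSpace (C : CSSCode SX SZ Q) : Set ((Q → ZMod 2) → ℂ) :=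
  {ψ | ∀ S ∈ C.stabilizer, S *ᵥ ψ = ψ}

/-- The logical CNOT operator `(1 + Z̄)/2 + (1 - Z̄)/2 * X̄`, where `Z̄` is the logical `Z` of the control
and `X̄` the logical `X` of the target. -/
noncomputable def logicalCNOT (z x : Q → ZMod 2) : Matrix (Q → ZMod 2) (Q → ZMod 2) ℂ :=
  (1 / 2 : ℂ) • (1 + zOp z) + (1 / 2 : ℂ) • ((1 - zOp z) * xOp x)

/-- The operator `U` implements the logical CNOT with control `c` and target `t` on the code `C` with
logical operators `LX`, `LZ`: it normalizes the stabilizer group, it conjugates the logical Pauli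
operators (modulo stabilizers) in the way CNOT does, leaving those of all other logical qubits fixed,
and on the code space it is equal to the logical CNOT operator. -/
structure ImplementsLogicalCNOT (C : CSSCode SX SZ Q) (LX LZ : ι → Q → ZMod 2) (c t : ι)
    (U : Matrix (Q → ZMod 2) (Q → ZMod 2) ℂ) : Prop where
  unitary : U ∈ Matrix.unitaryGroup (Q → ZMod 2) ℂ
  normalizes : ∀ S, U * S * Uᴴ ∈ C.stabilizer ↔ S ∈ C.stabilizer
  x_control : ∃ S ∈ C.stabilizer, U * xOp (LX c) * Uᴴ = xOp (LX c) * xOp (LX t) * S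
  x_other : ∀ i, i ≠ c → ∃ S ∈ C.stabilizer, U * xOp (LX i) * Uᴴ = xOp (LX i) * S
  z_target : ∃ S ∈ C.stabilizer, U * zOp (LZ t) * Uᴴ = zOp (LZ c) * zOp (LZ t) * S
  z_other : ∀ i, i ≠ t → ∃ S ∈ C.stabilizer, U * zOp (LZ i) * Uᴴ = zOp (LZ i) * S
  on_codeSpace : ∀ ψ ∈ C.codeSpace, U *ᵥ ψ = logicalCNOT (LZ c) (LX t) *ᵥ ψ

end CSSCode

/-! ### Auxiliary graphs with adapter edges -/

/-- The cyclic shift matrix `C`, with entries `|j⟩⟨j+1|`, so that `e_j C = e_{j+1}`. -/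
def shiftMatrix (m : ℕ) : Matrix (ZMod m) (ZMod m) (ZMod 2) :=
  Matrix.of fun j l => if l = j + 1 then 1 else 0

/-- The cyclic check matrix `H_C = I + C` of the repetition code. -/
def cyclicCheck (m : ℕ) : Matrix (ZMod m) (ZMod m) (ZMod 2) := 1 + shiftMatrix m

/-- The incidence matrix of a graph; rows are edges and columns are vertices. -/
def incidence {V : Type*} [DecidableEq V] (G : SimpleGraph V) : Matrix G.edgeSet V (ZMod 2) :=
  Matrix.of fun e v => if v ∈ (e : Sym2 V) then 1 else 0

/-- An auxiliary graph for the operator with support `L`, together with adapter edges.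
`H` is the check matrix of the checks (of type opposite to that of the operator) that are deformed,
and `R` is the repetition code check matrix of the toric code layer to which the graph is attached. -/
structure AuxGraph {S Q V : Type*} [Fintype Q] [Fintype V] [DecidableEq V] {m : ℕ} [NeZero m]
    (H : Matrix S Q (ZMod 2)) (L : Q → ZMod 2) (G : SimpleGraph V) [DecidableRel G.Adj]
    (U : Type*) (R : Matrix (ZMod m) (ZMod m) (ZMod 2)) where
  connected : G.Connected
  /-- The port function, from the support of the operator to the vertices. -/
  port : {q : Q // L q ≠ 0} ↪ V
  /-- A complete set of cycles, one for each row. -/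
  N : Matrix U G.edgeSet (ZMod 2)
  cycles : ∀ w : G.edgeSet → ZMod 2,
    w ᵥ* incidence G = 0 ↔ w ∈ Submodule.span (ZMod 2) (Set.range N)
  /-- For each check, edges of a matching of the vertices at which the check meets the port. -/
  M : Matrix S G.edgeSet (ZMod 2)
  matching : ∀ s v, (M * incidence G) s v = ∑ q, if port q = v then H s q.1 else 0
  /-- The vertex labelled `j` by the permutation matrix `P` of the adapter. -/
  label : ZMod m ↪ V
  /-- The edge sets joined to the checks of the toric code layer. -/
  T : Matrix (ZMod m) G.edgeSet (ZMod 2)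
  adapter : ∀ j v, (T * incidence G) j v = ∑ l, if label l = v then R j l else 0

namespace AuxGraph

variable {S Q V U : Type*} [Fintype Q] [Fintype V] [DecidableEq V] {m : ℕ} [NeZero m]
  {H : Matrix S Q (ZMod 2)} {L : Q → ZMod 2} {G : SimpleGraph V} [DecidableRel G.Adj]
  {R : Matrix (ZMod m) (ZMod m) (ZMod 2)}

/-- The matrix `F`, with entry `1` at `(q, v)` if and only if `q` is in the support and is sent to `v`
by the port function. -/
def F (A : AuxGraph H L G U R) (q : Q) (v : V) : ZMod 2 :=
  if h : L q ≠ 0 then (if A.port ⟨q, h⟩ = v then 1 else 0) else 0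

/-- The matrix `P`, with entry `1` at `(v, j)` if and only if the vertex `v` has label `j`. -/
def P (A : AuxGraph H L G U R) (v : V) (j : ZMod m) : ZMod 2 :=
  if A.label j = v then 1 else 0

end AuxGraph

/-! ### The merged code -/

/-- Qubits of the merged code: the original qubits, the edge qubits of the two auxiliary graphs, and the
qubits of the toric code; `torZ i j` and `torX i j` are the qubits with index `j` of the sets `Q^Z_i` and
`Q^X_i` in layer `i`. -/
inductive Qubit (Q EZ EX : Type*) (m : ℕ)
  | orig (q : Q)
  | edgeZ (e : EZ)
  | edgeX (e : EX)
  | torZ (i j : ZMod m)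
  | torX (i j : ZMod m)
  deriving DecidableEq

namespace Qubit

variable {Q EZ EX : Type*} {m : ℕ}

/-- Qubits as a sum type. -/
def equivSum : Qubit Q EZ EX m ≃
    Q ⊕ EZ ⊕ EX ⊕ (ZMod m × ZMod m) ⊕ (ZMod m × ZMod m) where
  toFun
    | orig q => .inl q
    | edgeZ e => .inr (.inl e)
    | edgeX e => .inr (.inr (.inl e))
    | torZ i j => .inr (.inr (.inr (.inl (i, j))))
    | torX i j => .inr (.inr (.inr (.inr (i, j))))
  invFun
    | .inl q => orig q
    | .inr (.inl e) => edgeZ e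
    | .inr (.inr (.inl e)) => edgeX e
    | .inr (.inr (.inr (.inl (i, j)))) => torZ i j
    | .inr (.inr (.inr (.inr (i, j)))) => torX i j
  left_inv x := by cases x <;> rfl
  right_inv x := by rcases x with x | x | x | ⟨_, _⟩ | ⟨_, _⟩ <;> rfl

instance [Fintype Q] [Fintype EZ] [Fintype EX] [NeZero m] : Fintype (Qubit Q EZ EX m) :=
  Fintype.ofEquiv _ equivSum.symm

theorem sum_eq [Fintype Q] [Fintype EZ] [Fintype EX] [NeZero m]
    {M : Type*} [AddCommMonoid M] (f : Qubit Q EZ EX m → M) :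
    ∑ x, f x = ∑ q, f (orig q) + (∑ e, f (edgeZ e) + (∑ e, f (edgeX e) +
      (∑ i, ∑ j, f (torZ i j) + ∑ i, ∑ j, f (torX i j)))) := by
  rw [← equivSum.symm.sum_comp f]
  simp only [Fintype.sum_sum_type, Fintype.sum_prod_type]
  rfl

/-- The permutation of the qubits by `C^p` on the set `Q^Z_i`, `e_j ↦ e_j C^p = e_{j+p}`. -/
def shiftZ (i p : ZMod m) : Equiv.Perm (Qubit Q EZ EX m) where
  toFun
    | torZ i' j => if i' = i then torZ i' (j + p) else torZ i' j
    | x => x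
  invFun
    | torZ i' j => if i' = i then torZ i' (j - p) else torZ i' j
    | x => x
  left_inv x := by
    cases x with
    | torZ i' j => by_cases h : i' = i <;> simp [h]
    | _ => rfl
  right_inv x := by
    cases x with
    | torZ i' j => by_cases h : i' = i <;> simp [h]
    | _ => rfl

/-- The permutation of the qubits by `C^p` on the set `Q^X_i`, `e_j ↦ e_j C^p = e_{j+p}`. -/
def shiftX (i p : ZMod m) : Equiv.Perm (Qubit Q EZ EX m) where
  toFun
    | torX i' j => if i' = i then torX i' (j + p) else torX i' j
    | x => x
  invFun
    | torX i' j => if i' = i then torX i' (j - p) else torX i' j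
    | x => x
  left_inv x := by
    cases x with
    | torX i' j => by_cases h : i' = i <;> simp [h]
    | _ => rfl
  right_inv x := by
    cases x with
    | torX i' j => by_cases h : i' = i <;> simp [h]
    | _ => rfl

end Qubit

/-- Checks of one type of the merged code: deformed original checks, cycle checks of one auxiliary graph,
toric code checks `tor i j` (index `j` in layer `i`) and vertex checks of the other auxiliary graph. -/
inductive Check (S U V : Type*) (m : ℕ)
  | orig (s : S)
  | cyc (u : U)
  | tor (i j : ZMod m)
  | vert (v : V)

section Merged

variable {SX SZ Q VZ UZ VX UX : Type*} [Fintype Q]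
  [Fintype VZ] [DecidableEq VZ] [Fintype VX] [DecidableEq VX]
  {m : ℕ} [NeZero m] {C : CSSCode SX SZ Q} {lz lx : Q → ZMod 2}
  {GZ : SimpleGraph VZ} [DecidableRel GZ.Adj] {GX : SimpleGraph VX} [DecidableRel GX.Adj]

/-- `X`-checks of the toric code on its own qubits: the check with index `j` of the set `C^X_i`
acts by `H_C` on `Q^Z_i` and by the identity matrix on `Q^X_i` and on `Q^X_{i-1}`. -/
def toricHX (EZ EX : Type*) (i j : ZMod m) : Qubit Q EZ EX m → ZMod 2
  | .torZ i' j' => if i' = i then cyclicCheck m j j' else 0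
  | .torX i' j' => (if i' = i ∧ j' = j then 1 else 0) + (if i' = i - 1 ∧ j' = j then 1 else 0)
  | _ => 0

/-- `Z`-checks of the toric code on its own qubits: the check with index `j` of the set `C^Z_i`
acts by `H_Cᵀ` on `Q^X_i` and by the identity matrix on `Q^Z_i` and on `Q^Z_{i+1}`. -/
def toricHZ (EZ EX : Type*) (i j : ZMod m) : Qubit Q EZ EX m → ZMod 2
  | .torZ i' j' => (if i' = i ∧ j' = j then 1 else 0) + (if i' = i + 1 ∧ j' = j then 1 else 0)
  | .torX i' j' => if i' = i then (cyclicCheck m)ᵀ j j' else 0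
  | _ => 0

/-- The `X`-check matrix of the merged code. -/
def mergedHX (AZ : AuxGraph C.HX lz GZ UZ (cyclicCheck m))
    (AX : AuxGraph C.HZ lx GX UX (cyclicCheck m)ᵀ) :
    Matrix (Check SX UZ VX m) (Qubit Q GZ.edgeSet GX.edgeSet m) (ZMod 2) := Matrix.of fun r x =>
  match r, x with
  | .orig s, .orig q => C.HX s q
  | .orig s, .edgeZ e => AZ.M s e
  | .cyc u, .edgeZ e => AZ.N u e
  | .tor i j, .edgeZ e => if i = 0 then AZ.T j e else 0
  | .tor i j, x => toricHX _ _ i j x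
  | .vert v, .orig q => AX.F q v
  | .vert v, .edgeX e => incidence GX e v
  | .vert v, .torX i j => if i = -1 then AX.P v j else 0
  | _, _ => 0

/-- The `Z`-check matrix of the merged code. -/
def mergedHZ (AZ : AuxGraph C.HX lz GZ UZ (cyclicCheck m))
    (AX : AuxGraph C.HZ lx GX UX (cyclicCheck m)ᵀ) :
    Matrix (Check SZ UX VZ m) (Qubit Q GZ.edgeSet GX.edgeSet m) (ZMod 2) := Matrix.of fun r x =>
  match r, x with
  | .orig s, .orig q => C.HZ s q
  | .orig s, .edgeX e => AX.M s e
  | .cyc u, .edgeX e => AX.N u e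
  | .tor i j, .edgeX e => if i = -1 then AX.T j e else 0
  | .tor i j, x => toricHZ _ _ i j x
  | .vert v, .orig q => AZ.F q v
  | .vert v, .edgeZ e => incidence GZ e v
  | .vert v, .torZ i j => if i = 0 then AZ.P v j else 0
  | _, _ => 0


theorem AuxGraph.sum_mul_F {S Q V U : Type*} [Fintype Q] [Fintype V] [DecidableEq V]
    {H : Matrix S Q (ZMod 2)} {L : Q → ZMod 2} {G : SimpleGraph V} [DecidableRel G.Adj]
    {R : Matrix (ZMod m) (ZMod m) (ZMod 2)} (A : AuxGraph H L G U R) (s : S) (v : V) :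
    ∑ q, H s q * A.F q v = (A.M * incidence G) s v := by
  rw [A.matching, ← Fintype.sum_subtype_add_sum_subtype (fun q => L q ≠ 0)
    (fun q => H s q * A.F q v), Finset.sum_eq_zero (s := (Finset.univ : Finset {q // ¬ (L q ≠ 0)})),
    add_zero]
  · refine Finset.sum_congr rfl fun q _ => ?_
    simp [AuxGraph.F, q.2]
  · intro q _
    have h : L q = 0 := not_not.1 q.2
    simp [AuxGraph.F, h]

theorem AuxGraph.sum_N {S Q V U : Type*} [Fintype Q] [Fintype V] [DecidableEq V]
    {H : Matrix S Q (ZMod 2)} {L : Q → ZMod 2} {G : SimpleGraph V} [DecidableRel G.Adj]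
    {R : Matrix (ZMod m) (ZMod m) (ZMod 2)} (A : AuxGraph H L G U R) (u : U) (v : V) :
    ∑ e, A.N u e * incidence G e v = 0 :=
  congrFun ((A.cycles (A.N u)).2 (Submodule.subset_span ⟨u, rfl⟩)) v

theorem merged_comm (hdisj : ∀ q, lz q = 0 ∨ lx q = 0)
    (AZ : AuxGraph C.HX lz GZ UZ (cyclicCheck m))
    (AX : AuxGraph C.HZ lx GX UX (cyclicCheck m)ᵀ) :
    mergedHX AZ AX * (mergedHZ AZ AX)ᵀ = 0 := by
  have two : ∀ a : ZMod 2, a + a = 0 := by decide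
  have hF : ∀ q v w, AX.F q v * AZ.F q w = 0 := by
    intro q v w
    rcases hdisj q with h | h <;> simp [AuxGraph.F, h]
  have hC := fun s s' => congrFun (congrFun C.comm s) s'
  simp only [Matrix.mul_apply, Matrix.transpose_apply, Matrix.zero_apply] at hC
  have hAZ := AZ.adapter
  have hAX := AX.adapter
  have hMZ := AZ.sum_mul_F
  have hMX := AX.sum_mul_F
  simp only [Matrix.mul_apply] at hAZ hAX hMZ hMX
  have tor : ∀ i j i' j' : ZMod m,
      ∑ x, ∑ y, toricHX GZ.edgeSet GX.edgeSet (Q := Q) i j (.torZ x y)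
        * toricHZ GZ.edgeSet GX.edgeSet (Q := Q) i' j' (.torZ x y)
      + ∑ x, ∑ y, toricHX GZ.edgeSet GX.edgeSet (Q := Q) i j (.torX x y)
        * toricHZ GZ.edgeSet GX.edgeSet (Q := Q) i' j' (.torX x y) = 0 := by
    intro i j i' j'
    have e1 : ∑ x, ∑ y, toricHX GZ.edgeSet GX.edgeSet (Q := Q) i j (.torZ x y)
        * toricHZ GZ.edgeSet GX.edgeSet (Q := Q) i' j' (.torZ x y)
        = (if i' = i then cyclicCheck m j j' else 0)
          + if i' + 1 = i then cyclicCheck m j j' else 0 := by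
      simp [toricHX, toricHZ, mul_add, Finset.sum_add_distrib, ite_and]
    have e2 : ∑ x, ∑ y, toricHX GZ.edgeSet GX.edgeSet (Q := Q) i j (.torX x y)
        * toricHZ GZ.edgeSet GX.edgeSet (Q := Q) i' j' (.torX x y)
        = (if i' = i then cyclicCheck m j j' else 0)
          + if i' = i - 1 then cyclicCheck m j j' else 0 := by
      simp [toricHX, toricHZ, add_mul, Finset.sum_add_distrib, ite_and]
    rw [e1, e2]
    simp only [eq_sub_iff_add_eq]
    exact two _
  have t1 : ∀ i j q, toricHX (Q := Q) GZ.edgeSet GX.edgeSet (m := m) i j (.orig q) = 0 :=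
    fun _ _ _ => rfl
  have t2 : ∀ i j e, toricHX (Q := Q) GZ.edgeSet GX.edgeSet (m := m) i j (.edgeX e) = 0 :=
    fun _ _ _ => rfl
  have t3 : ∀ i j q, toricHZ (Q := Q) GZ.edgeSet GX.edgeSet (m := m) i j (.orig q) = 0 :=
    fun _ _ _ => rfl
  have t4 : ∀ i j e, toricHZ (Q := Q) GZ.edgeSet GX.edgeSet (m := m) i j (.edgeZ e) = 0 :=
    fun _ _ _ => rfl
  ext r r'
  rw [Matrix.mul_apply, Qubit.sum_eq]
  cases r <;> cases r' <;> simp [mergedHX, mergedHZ, t1, t2, t3, t4]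
  case orig.orig s s' => exact hC s s'
  case orig.vert s v => rw [hMZ]; exact two _
  case cyc.vert u v => exact AZ.sum_N u v
  case tor.tor i j i' j' => exact tor i j i' j'
  case tor.vert i j v =>
    by_cases h : i = 0
    · simp [toricHX, h, hAZ, AuxGraph.P, two]
    · simp [toricHX, h, Ne.symm h]
  case vert.orig v s =>
    simp only [mul_comm (AX.F _ _), mul_comm (incidence _ _ _), hMX]
    exact two _
  case vert.cyc v u =>
    simp only [mul_comm (incidence _ _ _)]
    exact AX.sum_N u v
  case vert.tor v i j =>
    by_cases h : i = -1
    · simp [toricHZ, h, mul_comm (incidence _ _ _), hAX, AuxGraph.P, two]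
    · simp [toricHZ, h, Ne.symm h]
  case vert.vert v w => exact Finset.sum_eq_zero fun q _ => hF q v w

/-- The merged code, obtained by merging `C` with the toric code by means of the auxiliary graph `GZ`
on the logical operator `Z(lz)` and the auxiliary graph `GX` on the logical operator `X(lx)`.
The last layer of the toric code has index `m - 1 = -1`. -/
def mergedCode (hdisj : ∀ q, lz q = 0 ∨ lx q = 0)
    (AZ : AuxGraph C.HX lz GZ UZ (cyclicCheck m))
    (AX : AuxGraph C.HZ lx GX UX (cyclicCheck m)ᵀ) :
    CSSCode (Check SX UZ VX m) (Check SZ UX VZ m) (Qubit Q GZ.edgeSet GX.edgeSet m) where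
  HX := mergedHX AZ AX
  HZ := mergedHZ AZ AX
  comm := merged_comm hdisj AZ AX

end Merged

/-! ### Logical operators carried over to the merged code -/

section Deformation

variable {SX SZ Q EZ EX : Type*} [Fintype Q] [DecidableEq EZ] [DecidableEq EX] {m : ℕ}

/-- An operator of the original code, as an operator on the qubits of the merged code. -/
def embed (EZ EX : Type*) (m : ℕ) (u : Q → ZMod 2) : Qubit Q EZ EX m → ZMod 2
  | .orig q => u q
  | _ => 0

/-- The toric code logical operator `X̄^(1)`, supported on the qubit `e_0` of each set `Q^Z_i`. -/
def toricX1 (Q EZ EX : Type*) (m : ℕ) : Qubit Q EZ EX m → ZMod 2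
  | .torZ _ j => if j = 0 then 1 else 0
  | _ => 0

/-- The toric code logical operator `Z̄^(2)`, supported on the qubit `e_0` of each set `Q^X_i`. -/
def toricZ2 (Q EZ EX : Type*) (m : ℕ) : Qubit Q EZ EX m → ZMod 2
  | .torX _ j => if j = 0 then 1 else 0
  | _ => 0

/-- Supports of the `X`-type stabilizers of the system before merging: those of the original code, with
the edge qubits of the first auxiliary graph in the state `|+⟩` and the toric code in the logical state
`|+0⟩`. -/
def initialX (C : CSSCode SX SZ Q) (EZ EX : Type*) [DecidableEq EZ] (m : ℕ) :
    Submodule (ZMod 2) (Qubit Q EZ EX m → ZMod 2) :=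
  Submodule.span (ZMod 2)
    (Set.range (fun s => embed EZ EX m (C.HX s)) ∪
      Set.range (fun (e : EZ) (x : Qubit Q EZ EX m) =>
        match x with
        | .edgeZ e' => if e' = e then 1 else 0
        | _ => 0) ∪
      Set.range (fun p : ZMod m × ZMod m => toricHX EZ EX p.1 p.2) ∪ {toricX1 Q EZ EX m})

/-- Supports of the `Z`-type stabilizers of the system before merging: those of the original code, with
the edge qubits of the second auxiliary graph in the state `|0⟩` and the toric code in the logical state
`|+0⟩`. -/
def initialZ (C : CSSCode SX SZ Q) (EZ EX : Type*) [DecidableEq EX] (m : ℕ) :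
    Submodule (ZMod 2) (Qubit Q EZ EX m → ZMod 2) :=
  Submodule.span (ZMod 2)
    (Set.range (fun s => embed EZ EX m (C.HZ s)) ∪
      Set.range (fun (e : EX) (x : Qubit Q EZ EX m) =>
        match x with
        | .edgeX e' => if e' = e then 1 else 0
        | _ => 0) ∪
      Set.range (fun p : ZMod m × ZMod m => toricHZ EZ EX p.1 p.2) ∪ {toricZ2 Q EZ EX m})

/-- `X(x)` is a representative, on the merged code `D`, of the logical operator `X(u)` of the original
code `C`: it commutes with the checks of `D` and is the product of `X(u)` and an `X`-type stabilizer of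
the system before merging. -/
def RepresentsX {RX RZ : Type*} [Fintype (Qubit Q EZ EX m)] (C : CSSCode SX SZ Q)
    (D : CSSCode RX RZ (Qubit Q EZ EX m)) (u : Q → ZMod 2) (x : Qubit Q EZ EX m → ZMod 2) : Prop :=
  D.HZ *ᵥ x = 0 ∧ x - embed EZ EX m u ∈ initialX C EZ EX m

/-- `Z(z)` is a representative, on the merged code `D`, of the logical operator `Z(u)` of the original
code `C`. -/
def RepresentsZ {RX RZ : Type*} [Fintype (Qubit Q EZ EX m)] (C : CSSCode SX SZ Q)
    (D : CSSCode RX RZ (Qubit Q EZ EX m)) (u : Q → ZMod 2) (z : Qubit Q EZ EX m → ZMod 2) : Prop :=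
  D.HX *ᵥ z = 0 ∧ z - embed EZ EX m u ∈ initialZ C EZ EX m

end Deformation

/-! ### The circuit -/

section Circuit

variable {Q EZ EX : Type*} {m : ℕ} [NeZero m] [Fintype Q] [Fintype EZ] [Fintype EX]
  [DecidableEq Q] [DecidableEq EZ] [DecidableEq EX]

/-- The transversal gate `CNOT(Q^Z_i, Q^X_i) = ∏_j CNOT(torZ i j, torX i j)`. -/
def transversalCNOT (Q EZ EX : Type*) {m : ℕ} [NeZero m] [Fintype Q] [Fintype EZ] [Fintype EX]
    [DecidableEq Q] [DecidableEq EZ] [DecidableEq EX] (i : ZMod m) :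
    Matrix (Qubit Q EZ EX m → ZMod 2) (Qubit Q EZ EX m → ZMod 2) ℂ :=
  ((List.range m).map fun j : ℕ => cnotGate (Qubit.torZ i (j : ZMod m)) (.torX i (j : ZMod m))).prod

/-- The circuit `∏_{i=0}^{m-1} Γ'_i(Q^Z_i) Γ_i(Q^X_i) CNOT(Q^Z_i, Q^X_i)`, where `Γ'_i` permutes by `C^{-i}`
and `Γ_i` permutes by `C^{-i-1}`. -/
def dehnTwist (Q EZ EX : Type*) (m : ℕ) [NeZero m] [Fintype Q] [Fintype EZ] [Fintype EX]
    [DecidableEq Q] [DecidableEq EZ] [DecidableEq EX] :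
    Matrix (Qubit Q EZ EX m → ZMod 2) (Qubit Q EZ EX m → ZMod 2) ℂ :=
  ((List.range m).map fun i : ℕ =>
    permGate (Qubit.shiftZ (i : ZMod m) (-(i : ZMod m))) *
      permGate (Qubit.shiftX (i : ZMod m) (-(i : ZMod m) - 1)) *
      transversalCNOT Q EZ EX (i : ZMod m)).prod

end Circuit

end ToricAdapter

namespace ToricAdapter

open Matrix

/-! ### Orthogonality over a field -/

section Orthogonality

variable {K n : Type*} [Field K] [Fintype n] [DecidableEq n]

/-! CNOTs and qubit permutations permute the computational basis linearly over `ZMod 2`, so the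
circuit is `|s⟩ ↦ |A s⟩` with `A = twist` (`dehnTwist_eq`). Conjugation sends `X(u)` to `X(A u)` and
acts on `Z`-type operators by the inverse transpose. By `implementsLogicalCNOT_basisMap` it suffices
that `A` preserves the span of the `X`-checks and sends each `s` in the kernel of the `Z`-checks to
`s + (Z̄_c · s) X̄_t` modulo that span; the statements about `Z̄` and about the code space follow by
duality.

The checks are respected because the circuit only relabels the toric ones (`twist_mergedHX`,
`mergedHZ_twist`): a shift depending on the layer, combined with the copy of `H_C` made by the
CNOTs, turns check `j` of a layer into another check of that layer. The two layers glued to the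
auxiliary graphs are harmless, since the shifts vanish on `Q^Z_0` and `Q^X_{-1}`.

The logical action comes from an intersection number. A merged `X̄^(i)` contains the toric loop
`X̄^(1)` exactly when it anticommutes with `Z̄^(c)`, that is for `i = c`; a merged `Z̄^(j)` contains
the loop `Z̄^(2)` exactly for `j = t`. The circuit also spreads the first loop to a diagonal on the
sets `Q^X_i`, which meets the second in the single qubit `torX (-1) 0`. Hence `A X̄^(i) · Z̄^(j) =
δ_ij + δ_ic δ_tj` (`twist_logicalX_dotProduct_logicalZ`).

Such pairings determine a class only if there are no further logical qubits. This is
`merged_x_complete`: a commuting `X`-type operator is cleared by checks from the edges of `GX`, then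
from the toric code up to a multiple of the loop, until an operator of the original code remains.
Completeness for `Z` is dual. The choice of representatives does not matter, since the stabilizers
before merging commute and so pairings are those of the original operators
(`represents_dotProduct`). -/

theorem exists_dotProduct_eq (f : (n → K) →ₗ[K] K) : ∃ y : n → K, ∀ x, f x = y ⬝ᵥ x := by
  refine ⟨fun q => f (Pi.single q 1), fun x => ?_⟩
  conv_lhs => rw [pi_eq_sum_univ' x, map_sum]
  refine Finset.sum_congr rfl fun q _ => ?_
  rw [map_smul, smul_eq_mul, mul_comm]

/-- A vector outside `W` is separated from `W` by a linear functional, which is a dot product; thus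
`W` is its own double orthogonal complement. -/
theorem mem_of_forall_dotProduct_eq_zero (W : Submodule K (n → K)) (x : n → K)
    (h : ∀ y, (∀ w ∈ W, y ⬝ᵥ w = 0) → y ⬝ᵥ x = 0) : x ∈ W := by
  by_contra hx
  obtain ⟨f, hf, hW⟩ := Submodule.exists_le_ker_of_notMem hx
  obtain ⟨y, hy⟩ := exists_dotProduct_eq f
  refine hf ?_
  rw [hy]
  refine h y fun w hw => ?_
  rw [← hy]
  exact hW hw

omit [DecidableEq n] in
theorem mulVec_eq_zero_iff_span {S : Type*} (H : Matrix S n K) (y : n → K) :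
    H *ᵥ y = 0 ↔ ∀ w ∈ Submodule.span K (Set.range H), y ⬝ᵥ w = 0 := by
  constructor
  · intro h w hw
    induction hw using Submodule.span_induction with
    | mem w hw =>
      obtain ⟨s, rfl⟩ := hw
      rw [dotProduct_comm]
      exact congrFun h s
    | zero => simp
    | add u v _ _ hu hv => rw [dotProduct_add, hu, hv, add_zero]
    | smul a u _ hu => rw [dotProduct_smul, hu, smul_zero]
  · intro h
    funext s
    exact (dotProduct_comm _ _).trans (h _ (Submodule.subset_span ⟨s, rfl⟩))

theorem mem_span_range_of_forall {S : Type*} (H : Matrix S n K) (x : n → K)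
    (h : ∀ y, H *ᵥ y = 0 → y ⬝ᵥ x = 0) : x ∈ Submodule.span K (Set.range H) :=
  mem_of_forall_dotProduct_eq_zero _ x fun y hy => h y ((mulVec_eq_zero_iff_span H y).2 hy)

/-- Equality of dimensions forces the image of `W` to be all of `W`. Invariance under the circuit
thus need only be checked in one direction. -/
theorem LinearEquiv.map_eq_of_map_le {V : Type*} [AddCommGroup V] [Module K V]
    [FiniteDimensional K V] (A : V ≃ₗ[K] V) (W : Submodule K V) (h : ∀ w ∈ W, A w ∈ W) (w : V) :
    A w ∈ W ↔ w ∈ W := by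
  refine ⟨fun hw => ?_, h w⟩
  have h1 : W.map (A : V →ₗ[K] V) ≤ W := by
    rintro _ ⟨w, hw, rfl⟩
    exact h w hw
  have h2 := Submodule.eq_of_le_of_finrank_eq h1 (LinearEquiv.finrank_map_eq A W)
  rw [← h2] at hw
  obtain ⟨w', hw', e⟩ := hw
  rwa [← A.injective e]

end Orthogonality

/-! ### Logical bases -/

namespace CSSCode

variable {SX SZ Q ι : Type*} [Fintype Q] [DecidableEq Q] [Fintype ι] [DecidableEq ι]

/-- The span of the `X`-checks. -/
abbrev spanX (C : CSSCode SX SZ Q) : Submodule (ZMod 2) (Q → ZMod 2) :=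
  Submodule.span (ZMod 2) (Set.range C.HX)

/-- The span of the `Z`-checks. -/
abbrev spanZ (C : CSSCode SX SZ Q) : Submodule (ZMod 2) (Q → ZMod 2) :=
  Submodule.span (ZMod 2) (Set.range C.HZ)

omit [DecidableEq Q] in
theorem mulVec_HZ_of_mem_spanX (C : CSSCode SX SZ Q) {x : Q → ZMod 2} (hx : x ∈ C.spanX) :
    C.HZ *ᵥ x = 0 := by
  induction hx using Submodule.span_induction with
  | mem w hw =>
    obtain ⟨s, rfl⟩ := hw
    funext r
    have := congrFun (congrFun C.comm s) r
    rw [Matrix.mul_apply] at this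
    simpa [mulVec, dotProduct, mul_comm] using this
  | zero => simp
  | add u v _ _ hu hv => rw [mulVec_add, hu, hv, add_zero]
  | smul a u _ hu => rw [mulVec_smul, hu, smul_zero]

omit [DecidableEq Q] in
theorem dotProduct_spanX (C : CSSCode SX SZ Q) {x z : Q → ZMod 2} (hx : x ∈ C.spanX)
    (hz : C.HX *ᵥ z = 0) : x ⬝ᵥ z = 0 := by
  rw [dotProduct_comm]
  exact (mulVec_eq_zero_iff_span _ _).1 hz x hx

omit [DecidableEq Q] in
/-- An `X`-type operator that commutes with all checks and with the logical operators `LZ` is a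
stabilizer. -/
theorem mem_spanX_of_pairing (C : CSSCode SX SZ Q) {LX LZ : ι → Q → ZMod 2}
    (z_comm : ∀ i, C.HX *ᵥ LZ i = 0)
    (pairing : ∀ i j, LX i ⬝ᵥ LZ j = if i = j then 1 else 0)
    {x : Q → ZMod 2} (hx : x ∈ C.spanX ⊔ Submodule.span (ZMod 2) (Set.range LX))
    (h : ∀ j, x ⬝ᵥ LZ j = 0) : x ∈ C.spanX := by
  obtain ⟨s, hs, l, hl, rfl⟩ := Submodule.mem_sup.1 hx
  obtain ⟨μ, rfl⟩ := (Submodule.mem_span_range_iff_exists_fun _).1 hl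
  have hμ : ∀ j, μ j = 0 := by
    intro j
    have := h j
    rw [add_dotProduct, C.dotProduct_spanX hs (z_comm j), zero_add, sum_dotProduct] at this
    simpa [smul_dotProduct, pairing] using this
  simpa [hμ] using hs

omit [DecidableEq Q] in
theorem sub_sum_dotProduct {LX LZ : ι → Q → ZMod 2}
    (pairing : ∀ i j, LX i ⬝ᵥ LZ j = if i = j then 1 else 0) (x : Q → ZMod 2) (j : ι) :
    (x - ∑ i, (x ⬝ᵥ LZ i) • LX i) ⬝ᵥ LZ j = 0 := by
  simp [sub_dotProduct, sum_dotProduct, smul_dotProduct, pairing]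

/-- Completeness of the `X`-type logical operators implies that of the `Z`-type ones. -/
theorem IsLogicalBasis.of_x_complete {C : CSSCode SX SZ Q} {LX LZ : ι → Q → ZMod 2}
    (x_comm : ∀ i, C.HZ *ᵥ LX i = 0) (z_comm : ∀ i, C.HX *ᵥ LZ i = 0)
    (pairing : ∀ i j, LX i ⬝ᵥ LZ j = if i = j then 1 else 0)
    (x_complete : ∀ x, C.HZ *ᵥ x = 0 →
      x ∈ C.spanX ⊔ Submodule.span (ZMod 2) (Set.range LX)) : C.IsLogicalBasis LX LZ where
  x_comm := x_comm
  z_comm := z_comm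
  pairing := pairing
  x_complete := x_complete
  z_complete z hz := by
    have pairing' : ∀ i j, LZ i ⬝ᵥ LX j = if i = j then 1 else 0 := fun i j => by
      rw [dotProduct_comm, pairing]
      simp [eq_comm]
    -- Once its pairings with `LX` are removed, `z` is orthogonal to the whole kernel of `HZ`, which
    -- is spanned by the `X`-checks and `LX`; hence it is in the row space of `HZ`.
    have hmem : z - ∑ i, (z ⬝ᵥ LX i) • LZ i ∈ C.spanZ := by
      refine mem_span_range_of_forall _ _ fun x hx => ?_
      obtain ⟨s, hs, l, hl, rfl⟩ := Submodule.mem_sup.1 (x_complete x hx)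
      obtain ⟨μ, rfl⟩ := (Submodule.mem_span_range_iff_exists_fun _).1 hl
      rw [add_dotProduct, C.dotProduct_spanX hs, zero_add, sum_dotProduct]
      · refine Finset.sum_eq_zero fun i _ => ?_
        rw [smul_dotProduct, dotProduct_comm, sub_sum_dotProduct pairing', smul_zero]
      · rw [mulVec_sub, hz, mulVec_sum]
        simp [mulVec_smul, z_comm]
    rw [← sub_add_cancel z (∑ i, (z ⬝ᵥ LX i) • LZ i)]
    refine Submodule.add_mem_sup hmem (Submodule.sum_mem _ fun i _ => ?_)
    exact Submodule.smul_mem _ _ (Submodule.subset_span ⟨i, rfl⟩)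

/-- Completeness carries over to any other families of logical operators with the same pairings. -/
theorem IsLogicalBasis.congr {C : CSSCode SX SZ Q} {LX LZ LX' LZ' : ι → Q → ZMod 2}
    (hL : C.IsLogicalBasis LX LZ) (x_comm : ∀ i, C.HZ *ᵥ LX' i = 0)
    (z_comm : ∀ i, C.HX *ᵥ LZ' i = 0)
    (pairing : ∀ i j, LX' i ⬝ᵥ LZ' j = if i = j then 1 else 0)
    (pairing' : ∀ i j, LX' i ⬝ᵥ LZ j = if i = j then 1 else 0) : C.IsLogicalBasis LX' LZ' := by
  refine .of_x_complete x_comm z_comm pairing fun x hx => ?_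
  rw [← sub_add_cancel x (∑ i, (x ⬝ᵥ LZ i) • LX' i)]
  refine Submodule.add_mem_sup ?_ (Submodule.sum_mem _ fun i _ =>
    Submodule.smul_mem _ _ (Submodule.subset_span ⟨i, rfl⟩))
  refine C.mem_spanX_of_pairing hL.z_comm hL.pairing (hL.x_complete _ ?_)
    (sub_sum_dotProduct pairing' x)
  rw [mulVec_sub, hx, mulVec_sum]
  simp [mulVec_smul, x_comm]

end CSSCode

/-! ### Reversible maps of the computational basis -/

section BasisMaps

variable {S : Type*} [DecidableEq S]

/-- The operator that maps each basis state `|s⟩` to `|f s⟩`. -/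
def basisMap (f : S → S) : Matrix S S ℂ := Matrix.of fun s' s => if s' = f s then 1 else 0

theorem basisMap_id : basisMap (id : S → S) = 1 := by
  ext s' s
  simp [basisMap, Matrix.one_apply]

variable [Fintype S]

theorem basisMap_mul (f g : S → S) : basisMap f * basisMap g = basisMap (f ∘ g) := by
  ext s' s
  simp [basisMap, Matrix.mul_apply]

omit [Fintype S] in
theorem basisMap_conjTranspose (f : S ≃ S) : (basisMap f)ᴴ = basisMap f.symm := by
  ext s' s
  simp only [basisMap, conjTranspose_apply, of_apply, apply_ite star, star_one, star_zero]
  simp [Equiv.eq_symm_apply, eq_comm]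

theorem basisMap_mulVec (f : S ≃ S) (ψ : S → ℂ) : basisMap f *ᵥ ψ = ψ ∘ f.symm := by
  funext s'
  simp [basisMap, mulVec, dotProduct, ← Equiv.symm_apply_eq]

theorem basisMap_mul_diagonal (f : S ≃ S) (d : S → ℂ) :
    basisMap f * diagonal d * basisMap f.symm = diagonal (d ∘ f.symm) := by
  ext s' s
  rw [Matrix.mul_apply]
  simp only [mul_diagonal, basisMap, of_apply, ite_mul, one_mul, zero_mul, mul_ite, mul_one, mul_zero]
  by_cases h : s' = s
  · subst h
    simp
  · simp [h]

theorem basisMap_mem_unitaryGroup (f : S ≃ S) : basisMap f ∈ Matrix.unitaryGroup S ℂ := by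
  rw [Matrix.mem_unitaryGroup_iff, star_eq_conjTranspose, basisMap_conjTranspose, basisMap_mul]
  simp [basisMap_id]

end BasisMaps

/-! ### Pauli operators and their conjugation by linear basis permutations -/

section Paulis

variable {Q : Type*} [Fintype Q] [DecidableEq Q]

omit [DecidableEq Q] in
theorem xOp_eq_basisMap (u : Q → ZMod 2) : xOp u = basisMap (· + u) := rfl

theorem xOp_add (u v : Q → ZMod 2) : xOp u * xOp v = xOp (u + v) := by
  simp only [xOp_eq_basisMap, basisMap_mul]
  congr 1
  funext s
  simp [add_assoc, add_comm u v]

omit [DecidableEq Q] in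
theorem xOp_zero : xOp (0 : Q → ZMod 2) = 1 := by
  rw [xOp_eq_basisMap, ← basisMap_id]
  congr 1
  funext s
  simp

theorem zOp_add (u v : Q → ZMod 2) : zOp u * zOp v = zOp (u + v) := by
  rw [zOp, zOp, zOp, diagonal_mul_diagonal]
  congr 1
  funext s
  rw [add_dotProduct]
  generalize u ⬝ᵥ s = a
  generalize v ⬝ᵥ s = b
  revert a b
  have h : ∀ a : ZMod 2, a = 0 ∨ a = 1 := by decide
  intro a b
  have two : (1 + 1 : ZMod 2) = 0 := by decide
  rcases h a with rfl | rfl <;> rcases h b with rfl | rfl <;> simp [two]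

omit [DecidableEq Q] in
theorem zOp_zero : zOp (0 : Q → ZMod 2) = 1 := by
  simp [zOp]

theorem basisMap_conj_xOp (A : (Q → ZMod 2) ≃ₗ[ZMod 2] (Q → ZMod 2)) (u : Q → ZMod 2) :
    basisMap A * xOp u * (basisMap A)ᴴ = xOp (A u) := by
  rw [show (basisMap A) = basisMap A.toEquiv from rfl, basisMap_conjTranspose, xOp_eq_basisMap,
    basisMap_mul, basisMap_mul, xOp_eq_basisMap]
  congr 1
  funext s
  simp

/-- The vector `v'` is the inverse transpose of `A` applied to `v`; only its pairings are ever
needed. -/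
theorem basisMap_conj_zOp (A : (Q → ZMod 2) ≃ₗ[ZMod 2] (Q → ZMod 2)) (v : Q → ZMod 2) :
    ∃ v', (∀ s, v' ⬝ᵥ s = v ⬝ᵥ A.symm s) ∧ basisMap A * zOp v * (basisMap A)ᴴ = zOp v' := by
  obtain ⟨v', hv'⟩ := exists_dotProduct_eq
    ((dotProductBilin (ZMod 2) (ZMod 2) v).comp (A.symm : (Q → ZMod 2) →ₗ[ZMod 2] (Q → ZMod 2)))
  refine ⟨v', fun s => (hv' s).symm, ?_⟩
  rw [show (basisMap A) = basisMap A.toEquiv from rfl, basisMap_conjTranspose, zOp,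
    basisMap_mul_diagonal, zOp]
  congr 1
  funext s
  rw [← hv' s]
  rfl

end Paulis

/-! ### Logical CNOT from a linear map of the computational basis -/

namespace CSSCode

variable {SX SZ Q ι : Type*} [Fintype Q] [DecidableEq Q] [Fintype ι] [DecidableEq ι]

omit [DecidableEq Q] in
theorem map_mem_spanX {C : CSSCode SX SZ Q}
    {A : (Q → ZMod 2) ≃ₗ[ZMod 2] (Q → ZMod 2)} (hX : ∀ s, A (C.HX s) ∈ C.spanX)
    {u : Q → ZMod 2} (hu : u ∈ C.spanX) : A u ∈ C.spanX := by
  have : C.spanX ≤ C.spanX.comap (A : (Q → ZMod 2) →ₗ[ZMod 2] (Q → ZMod 2)) :=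
    Submodule.span_le.2 (Set.range_subset_iff.2 hX)
  exact this hu

theorem xOp_mem_stabilizer (C : CSSCode SX SZ Q) {u : Q → ZMod 2} (hu : u ∈ C.spanX) :
    xOp u ∈ C.stabilizer := by
  induction hu using Submodule.span_induction with
  | mem w hw =>
    obtain ⟨s, rfl⟩ := hw
    exact Submonoid.subset_closure (.inl ⟨s, rfl⟩)
  | zero => rw [xOp_zero]; exact one_mem _
  | add u v _ _ hu hv => rw [← xOp_add]; exact mul_mem hu hv
  | smul a u _ hu =>
    have h : ∀ a : ZMod 2, a = 0 ∨ a = 1 := by decide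
    rcases h a with rfl | rfl
    · rw [zero_smul, xOp_zero]; exact one_mem _
    · rwa [one_smul]

theorem zOp_mem_stabilizer (C : CSSCode SX SZ Q) {u : Q → ZMod 2} (hu : u ∈ C.spanZ) :
    zOp u ∈ C.stabilizer := by
  induction hu using Submodule.span_induction with
  | mem w hw =>
    obtain ⟨s, rfl⟩ := hw
    exact Submonoid.subset_closure (.inr ⟨s, rfl⟩)
  | zero => rw [zOp_zero]; exact one_mem _
  | add u v _ _ hu hv => rw [← zOp_add]; exact mul_mem hu hv
  | smul a u _ hu =>
    have h : ∀ a : ZMod 2, a = 0 ∨ a = 1 := by decide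
    rcases h a with rfl | rfl
    · rw [zero_smul, zOp_zero]; exact one_mem _
    · rwa [one_smul]

theorem eq_xOp_mul {C : CSSCode SX SZ Q} {u v : Q → ZMod 2} (h : u - v ∈ C.spanX) :
    ∃ S ∈ C.stabilizer, xOp u = xOp v * S :=
  ⟨_, C.xOp_mem_stabilizer h, by rw [xOp_add, add_sub_cancel]⟩

theorem eq_zOp_mul {C : CSSCode SX SZ Q} {u v : Q → ZMod 2} (h : u - v ∈ C.spanZ) :
    ∃ S ∈ C.stabilizer, zOp u = zOp v * S :=
  ⟨_, C.zOp_mem_stabilizer h, by rw [zOp_add, add_sub_cancel]⟩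

/-- Since `spanZ` is the orthogonal complement of the kernel of `HZ`, invariance of `spanZ` under
the inverse transpose of `A` amounts to invariance of that kernel under `A.symm`, which is the form
of `hZ`. -/
theorem conj_mem_stabilizer (C : CSSCode SX SZ Q) (A : (Q → ZMod 2) ≃ₗ[ZMod 2] (Q → ZMod 2))
    (hX : ∀ u ∈ C.spanX, A u ∈ C.spanX) (hZ : ∀ s, C.HZ *ᵥ s = 0 → C.HZ *ᵥ A.symm s = 0)
    {S : Matrix (Q → ZMod 2) (Q → ZMod 2) ℂ} (hS : S ∈ C.stabilizer) :
    basisMap A * S * (basisMap A)ᴴ ∈ C.stabilizer := by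
  have hU := basisMap_mem_unitaryGroup A.toEquiv
  rw [Matrix.mem_unitaryGroup_iff, star_eq_conjTranspose] at hU
  have hU' := basisMap_mem_unitaryGroup A.toEquiv
  rw [Matrix.mem_unitaryGroup_iff', star_eq_conjTranspose] at hU'
  change basisMap A * (basisMap A)ᴴ = 1 at hU
  change (basisMap A)ᴴ * basisMap A = 1 at hU'
  induction hS using Submonoid.closure_induction with
  | mem S hS =>
    rcases hS with ⟨s, rfl⟩ | ⟨s, rfl⟩
    · dsimp only
      rw [basisMap_conj_xOp]
      exact C.xOp_mem_stabilizer (hX _ (Submodule.subset_span ⟨s, rfl⟩))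
    · obtain ⟨v', hv', e⟩ := basisMap_conj_zOp A (C.HZ s)
      dsimp only
      rw [e]
      refine C.zOp_mem_stabilizer (mem_span_range_of_forall _ _ fun y hy => ?_)
      rw [dotProduct_comm, hv']
      exact congrFun (hZ y hy) s
  | one => rw [mul_one, hU]; exact one_mem _
  | mul S T _ _ hS hT =>
    have : basisMap A * (S * T) * (basisMap A)ᴴ
        = (basisMap A * S * (basisMap A)ᴴ) * (basisMap A * T * (basisMap A)ᴴ) := by
      calc basisMap A * (S * T) * (basisMap A)ᴴ
          = basisMap A * S * 1 * T * (basisMap A)ᴴ := by simp only [mul_one, mul_assoc]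
        _ = _ := by rw [← hU']; simp only [mul_assoc]
    rw [this]
    exact mul_mem hS hT

theorem codeSpace_apply_add {C : CSSCode SX SZ Q} {ψ : (Q → ZMod 2) → ℂ} (hψ : ψ ∈ C.codeSpace)
    {u : Q → ZMod 2} (hu : u ∈ C.spanX) (s : Q → ZMod 2) : ψ (s + u) = ψ s := by
  have := congrFun (hψ _ (C.xOp_mem_stabilizer hu)) (s + u)
  rw [← this]
  simp [xOp, mulVec, dotProduct]

/-- A `Z`-check violated by `s` gives `ψ s = -ψ s`. -/
theorem codeSpace_apply_eq_zero {C : CSSCode SX SZ Q} {ψ : (Q → ZMod 2) → ℂ}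
    (hψ : ψ ∈ C.codeSpace) {s : Q → ZMod 2} (hs : C.HZ *ᵥ s ≠ 0) : ψ s = 0 := by
  obtain ⟨r, hr⟩ := Function.ne_iff.1 hs
  have := congrFun (hψ _ (C.zOp_mem_stabilizer (Submodule.subset_span ⟨r, rfl⟩))) s
  change C.HZ r ⬝ᵥ s ≠ 0 at hr
  rw [zOp, mulVec_diagonal, if_neg hr] at this
  have h2 : ψ s + ψ s = 0 := by nth_rewrite 1 [← this]; ring
  exact add_self_eq_zero.1 h2

theorem logicalCNOT_mulVec (z x : Q → ZMod 2) (ψ : (Q → ZMod 2) → ℂ) (s : Q → ZMod 2) :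
    (logicalCNOT z x *ᵥ ψ) s = if z ⬝ᵥ s = 0 then ψ s else ψ (s - x) := by
  have hx : ∀ s, (xOp x *ᵥ ψ) s = ψ (s - x) := fun s => by
    simp [xOp, mulVec, dotProduct, ← sub_eq_iff_eq_add]
  rw [logicalCNOT, add_mulVec, smul_mulVec, smul_mulVec, add_mulVec, one_mulVec,
    ← mulVec_mulVec, sub_mulVec, one_mulVec]
  simp only [Pi.add_apply, Pi.smul_apply, Pi.sub_apply, zOp, mulVec_diagonal, hx, smul_eq_mul]
  split_ifs <;> ring

omit [Fintype ι] in
/-- A linear map `A` of the computational basis that acts on the logical `X` operators in the way CNOT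
does implements the logical CNOT. -/
theorem implementsLogicalCNOT_basisMap {C : CSSCode SX SZ Q} {LX LZ : ι → Q → ZMod 2}
    (hL : C.IsLogicalBasis LX LZ) {c t : ι} (hct : c ≠ t)
    (A : (Q → ZMod 2) ≃ₗ[ZMod 2] (Q → ZMod 2)) (hX : ∀ s, A (C.HX s) ∈ C.spanX)
    (hA : ∀ s, C.HZ *ᵥ s = 0 → A s - (s + (LZ c ⬝ᵥ s) • LX t) ∈ C.spanX) :
    C.ImplementsLogicalCNOT LX LZ c t (basisMap A) := by
  have hX1 : ∀ u, A u ∈ C.spanX ↔ u ∈ C.spanX :=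
    LinearEquiv.map_eq_of_map_le A _ fun u hu => map_mem_spanX hX hu
  have hZ1 : ∀ s, C.HZ *ᵥ A s = 0 ↔ C.HZ *ᵥ s = 0 := by
    refine LinearEquiv.map_eq_of_map_le A (LinearMap.ker C.HZ.mulVecLin) fun s hs => ?_
    have hs : C.HZ *ᵥ s = 0 := hs
    have := C.mulVec_HZ_of_mem_spanX (hA s hs)
    rw [mulVec_sub, mulVec_add, hs, mulVec_smul, hL.x_comm, smul_zero, add_zero, sub_zero] at this
    exact this
  have hX2 : ∀ u, A.symm u ∈ C.spanX ↔ u ∈ C.spanX := fun u => by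
    rw [← hX1, A.apply_symm_apply]
  have hZ2 : ∀ s, C.HZ *ᵥ A.symm s = 0 ↔ C.HZ *ᵥ s = 0 := fun s => by
    rw [← hZ1, A.apply_symm_apply]
  -- Modulo stabilizers `A` is an involution: `c ≠ t` gives `LZ c ⬝ᵥ LX t = 0`, so `A` fixes `LX t`,
  -- and a second application cancels the added term.
  have hinv : ∀ s, C.HZ *ᵥ s = 0 → A.symm s - (s + (LZ c ⬝ᵥ s) • LX t) ∈ C.spanX := by
    intro s hs
    have two : ∀ a : ZMod 2, a + a = 0 := by decide
    have h1 := hA s hs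
    have h2 := (C.spanX.smul_mem (LZ c ⬝ᵥ s) (hA _ (hL.x_comm t)))
    rw [dotProduct_comm (LZ c) (LX t), hL.pairing, if_neg hct.symm, zero_smul, add_zero] at h2
    rw [← hX1, map_sub, A.apply_symm_apply, map_add, map_smul]
    have := C.spanX.neg_mem (add_mem h1 h2)
    convert this using 1
    have h3 : (LZ c ⬝ᵥ s) • LX t + (LZ c ⬝ᵥ s) • LX t = 0 := by rw [← add_smul, two, zero_smul]
    rw [smul_sub, eq_comm, ← sub_eq_zero, ← h3]
    abel
  -- The transpose of `hinv`: both vectors have the same pairing with every `s` in the kernel of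
  -- `HZ`, so they differ by a `Z`-check combination.
  have hZ3 : ∀ i v', (∀ s, v' ⬝ᵥ s = LZ i ⬝ᵥ A.symm s) →
      v' - (LZ i + (LZ i ⬝ᵥ LX t) • LZ c) ∈ C.spanZ := by
    intro i v' hv'
    refine mem_span_range_of_forall _ _ fun s hs => ?_
    have := C.dotProduct_spanX (hinv s hs) (hL.z_comm i)
    rw [dotProduct_comm] at this ⊢
    rw [sub_dotProduct, hv']
    simp only [dotProduct_sub, dotProduct_add, dotProduct_smul, add_dotProduct, smul_dotProduct,
      smul_eq_mul] at this ⊢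
    rw [← this]
    ring
  have hconj : (basisMap A)ᴴ = basisMap A.symm := basisMap_conjTranspose A.toEquiv
  have hU : basisMap A ∈ Matrix.unitaryGroup (Q → ZMod 2) ℂ := basisMap_mem_unitaryGroup A.toEquiv
  have hUU := Matrix.mem_unitaryGroup_iff'.1 hU
  rw [star_eq_conjTranspose] at hUU
  refine ⟨hU, fun S => ⟨fun h => ?_, C.conj_mem_stabilizer A (fun u => (hX1 u).2)
    fun s => (hZ2 s).2⟩, ?_, fun i hi => ?_, ?_, fun i hi => ?_, fun ψ hψ => ?_⟩
  · have := C.conj_mem_stabilizer A.symm (fun u => (hX2 u).2) (fun s => (hZ1 s).2) h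
    rw [← hconj, conjTranspose_conjTranspose] at this
    convert this using 1
    calc S = ((basisMap A)ᴴ * basisMap A) * S * ((basisMap A)ᴴ * basisMap A) := by
          rw [hUU, one_mul, mul_one]
      _ = _ := by simp only [mul_assoc]
  · rw [basisMap_conj_xOp, xOp_add]
    refine eq_xOp_mul ?_
    have := hA _ (hL.x_comm c)
    rwa [dotProduct_comm, hL.pairing, if_pos rfl, one_smul] at this
  · rw [basisMap_conj_xOp]
    refine eq_xOp_mul ?_
    have := hA _ (hL.x_comm i)
    rwa [dotProduct_comm, hL.pairing, if_neg hi, zero_smul, add_zero] at this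
  · obtain ⟨v', hv', e⟩ := basisMap_conj_zOp A (LZ t)
    rw [e, zOp_add]
    refine eq_zOp_mul ?_
    have := hZ3 t v' hv'
    rwa [dotProduct_comm, hL.pairing, if_pos rfl, one_smul, add_comm (LZ t)] at this
  · obtain ⟨v', hv', e⟩ := basisMap_conj_zOp A (LZ i)
    rw [e]
    refine eq_zOp_mul ?_
    have := hZ3 i v' hv'
    rwa [dotProduct_comm, hL.pairing, if_neg hi.symm, zero_smul, add_zero] at this
  · funext s
    rw [show basisMap A = basisMap A.toEquiv from rfl, basisMap_mulVec, logicalCNOT_mulVec]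
    change ψ (A.symm s) = _
    -- A code state is supported on the kernel of `HZ` and constant on cosets of `spanX`, so there
    -- `A.symm s` can be replaced by its class; off the kernel every term vanishes.
    by_cases hs : C.HZ *ᵥ s = 0
    · have h1 := codeSpace_apply_add hψ (hinv s hs) (s + (LZ c ⬝ᵥ s) • LX t)
      rw [add_sub_cancel] at h1
      rw [h1]
      have h : ∀ a : ZMod 2, a = 0 ∨ a = 1 := by decide
      rcases h (LZ c ⬝ᵥ s) with h | h
      · simp [h]
      · have hneg : -LX t = LX t := funext fun q => ZMod.neg_eq_self_mod_two _
        simp [h, sub_eq_add_neg, hneg]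
    · rw [codeSpace_apply_eq_zero hψ (mt (hZ2 s).1 hs), codeSpace_apply_eq_zero hψ hs,
        codeSpace_apply_eq_zero hψ, ite_self]
      rwa [mulVec_sub, hL.x_comm, sub_zero]

end CSSCode

/-! ### Auxiliary graphs -/

section Graphs

variable {V : Type*} [Fintype V] [DecidableEq V] (G : SimpleGraph V)

/-- An edge has two ends. Consequently the product of all vertex checks acts on no edge qubit. -/
theorem sum_incidence (e : G.edgeSet) : ∑ v, incidence G e v = 0 := by
  obtain ⟨e, he⟩ := e
  induction e using Sym2.inductionOn with
  | hf a b =>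
    have hab : a ≠ b := G.ne_of_adj he
    have : ∀ v, incidence G ⟨s(a, b), he⟩ v
        = (if v = a then 1 else 0) + (if v = b then 1 else 0) := by
      intro v
      by_cases h : v = a
      · subst h
        simp [incidence, hab]
      · simp [incidence, h]
    have two : (1 + 1 : ZMod 2) = 0 := by decide
    simp [this, Finset.sum_add_distrib, two]

variable {G} [DecidableRel G.Adj]

theorem exists_vecMul_incidence_walk {a b : V} (p : G.Walk a b) :
    ∃ e : G.edgeSet → ZMod 2, e ᵥ* incidence G = Pi.single a 1 + Pi.single b 1 := by
  have two : (1 + 1 : ZMod 2) = 0 := by decide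
  have two' : ∀ f : V → ZMod 2, f + f = 0 := fun f => by
    rw [← one_smul (ZMod 2) f, ← add_smul, two, zero_smul]
  induction p with
  | nil => exact ⟨0, by rw [two', zero_vecMul]⟩
  | @cons a d b h p ih =>
    obtain ⟨e, he⟩ := ih
    refine ⟨Pi.single ⟨s(a, d), h⟩ 1 + e, ?_⟩
    have h1 : incidence G ⟨s(a, d), h⟩ = Pi.single a 1 + Pi.single d 1 := by
      funext v
      have had : a ≠ d := G.ne_of_adj h
      by_cases hv : v = a
      · subst hv
        simp [incidence, had]
      · simp [incidence, hv, Pi.single_apply]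
    have h2 : incidence G ⟨s(a, d), h⟩ = (incidence G).row ⟨s(a, d), h⟩ := rfl
    rw [add_vecMul, he, single_one_vecMul, ← h2, h1, add_assoc, ← add_assoc (Pi.single d 1), two',
      zero_add]

/-- In a connected graph every vertex set of even size is the boundary of an edge set. -/
theorem exists_vecMul_incidence (hG : G.Connected) (w : V → ZMod 2) (hw : ∑ v, w v = 0) :
    ∃ e : G.edgeSet → ZMod 2, e ᵥ* incidence G = w := by
  obtain ⟨a⟩ := hG.nonempty
  choose e he using fun v => exists_vecMul_incidence_walk (hG.preconnected v a).some
  refine ⟨∑ v, w v • e v, ?_⟩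
  rw [sum_vecMul]
  simp only [smul_vecMul, he, smul_add, Finset.sum_add_distrib]
  -- Each vertex of the set was joined to the base vertex `a` by a walk; their contributions at `a`
  -- cancel because the set is even.
  rw [← Finset.sum_smul, hw, zero_smul, add_zero]
  exact (pi_eq_sum_univ' w).symm

namespace AuxGraph

variable {S Q U : Type*} [Fintype Q] {m : ℕ} [NeZero m]
  {H : Matrix S Q (ZMod 2)} {L : Q → ZMod 2} {R : Matrix (ZMod m) (ZMod m) (ZMod 2)}
  (A : AuxGraph H L G U R)

/-- The orthogonal complement of the cycle space is the cut space, and the rows of `N` span the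
cycles. -/
theorem exists_incidence_mulVec {x : G.edgeSet → ZMod 2} (hx : A.N *ᵥ x = 0) :
    ∃ p, x = incidence G *ᵥ p := by
  have : x ∈ LinearMap.range (incidence G).mulVecLin := by
    refine mem_of_forall_dotProduct_eq_zero _ _ fun y hy => ?_
    rw [dotProduct_comm]
    refine (mulVec_eq_zero_iff_span _ _).1 hx y ((A.cycles y).1 ?_)
    funext v
    have := hy _ ⟨Pi.single v 1, rfl⟩
    rwa [mulVecLin_apply, dotProduct_mulVec, dotProduct_single_one] at this
  obtain ⟨p, rfl⟩ := this
  exact ⟨p, rfl⟩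

/-- Each qubit of the support has exactly one port, so on the original qubits the product of all
vertex checks is the logical operator with support `L`. -/
theorem sum_F (q : Q) : ∑ v, A.F q v = L q := by
  have h : ∀ a : ZMod 2, a = 0 ∨ a = 1 := by decide
  rcases h (L q) with h | h <;> simp [F, h]

theorem sum_P (j : ZMod m) : ∑ v, A.P v j = 1 := by
  simp [P]

end AuxGraph

end Graphs

/-! ### The repetition code -/

section Repetition

variable {m : ℕ} [NeZero m]

theorem sum_mul_cyclicCheck (g : ZMod m → ZMod 2) (j' : ZMod m) :
    ∑ j, g j * cyclicCheck m j j' = g j' + g (j' - 1) := by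
  have : ∀ j, (j' = j + 1) = (j = j' - 1) := fun j => by
    rw [eq_sub_iff_add_eq, eq_comm (a := j + 1)]
  simp [cyclicCheck, shiftMatrix, Matrix.one_apply, mul_add, Finset.sum_add_distrib, this]

theorem sum_cyclicCheck_mul (g : ZMod m → ZMod 2) (j : ZMod m) :
    ∑ j', cyclicCheck m j j' * g j' = g j + g (j + 1) := by
  simp [cyclicCheck, shiftMatrix, Matrix.one_apply, add_mul, Finset.sum_add_distrib]

/-- Running sums solve the difference equation on the cycle cut open between `-1` and `0`; around
the closed cycle there is the obstruction `∑ h`, so `i = -1` is left out. -/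
theorem exists_add_shift (h : ZMod m → ZMod 2) :
    ∃ f : ZMod m → ZMod 2, ∀ i, i ≠ -1 → f i + f (i + 1) = h i := by
  have two : ∀ a : ZMod 2, a + a = 0 := by decide
  refine ⟨fun i => ∑ l ∈ Finset.range i.val, h l, fun i hi => ?_⟩
  have hlt : i.val + 1 < m := by
    refine lt_of_le_of_ne (ZMod.val_lt i) fun hm => hi ?_
    have : ((i.val + 1 : ℕ) : ZMod m) = 0 := by rw [hm, ZMod.natCast_self]
    rw [Nat.cast_add, ZMod.natCast_zmod_val, Nat.cast_one] at this
    exact eq_neg_of_add_eq_zero_left this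
  have hval : (i + 1).val = i.val + 1 := by
    have : i + 1 = ((i.val + 1 : ℕ) : ZMod m) := by
      rw [Nat.cast_add, ZMod.natCast_zmod_val, Nat.cast_one]
    rw [this, ZMod.val_natCast_of_lt hlt]
  dsimp only
  rw [hval, Finset.sum_range_succ, ← add_assoc, two, zero_add, ZMod.natCast_zmod_val]

theorem eq_of_forall_add_one {α : Type*} (f : ZMod m → α) (h : ∀ i, f (i + 1) = f i) (i : ZMod m) :
    f i = f 0 := by
  rw [← ZMod.natCast_zmod_val i]
  induction i.val with
  | zero => rw [Nat.cast_zero]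
  | succ n ih => rw [Nat.cast_add, Nat.cast_one, h, ih]

end Repetition

/-! ### Logical operators of the merged code -/

section MergedLogicals

variable {SX SZ Q VZ UZ VX UX : Type*} [Fintype Q]
  [Fintype VZ] [DecidableEq VZ] [Fintype VX] [DecidableEq VX]
  {m : ℕ} [NeZero m] {C : CSSCode SX SZ Q} {lz lx : Q → ZMod 2}
  {GZ : SimpleGraph VZ} [DecidableRel GZ.Adj] {GX : SimpleGraph VX} [DecidableRel GX.Adj]
  (AZ : AuxGraph C.HX lz GZ UZ (cyclicCheck m)) (AX : AuxGraph C.HZ lx GX UX (cyclicCheck m)ᵀ)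
  (x : Qubit Q GZ.edgeSet GX.edgeSet m → ZMod 2)

theorem mulVec_mergedHZ_orig (s : SZ) : (mergedHZ AZ AX *ᵥ x) (.orig s)
    = ∑ q, C.HZ s q * x (.orig q) + ∑ e, AX.M s e * x (.edgeX e) := by
  simp [mulVec, dotProduct, Qubit.sum_eq, mergedHZ]

theorem mulVec_mergedHZ_cyc (u : UX) : (mergedHZ AZ AX *ᵥ x) (.cyc u)
    = ∑ e, AX.N u e * x (.edgeX e) := by
  simp [mulVec, dotProduct, Qubit.sum_eq, mergedHZ]

theorem mulVec_mergedHZ_tor (i j : ZMod m) : (mergedHZ AZ AX *ᵥ x) (.tor i j)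
    = (if i = -1 then ∑ e, AX.T j e * x (.edgeX e) else 0)
      + ((x (.torZ i j) + x (.torZ (i + 1) j)) + (x (.torX i j) + x (.torX i (j - 1)))) := by
  have h := sum_mul_cyclicCheck (fun j' => x (.torX i j')) j
  simp only [mul_comm] at h
  rw [← h]
  simp [mulVec, dotProduct, Qubit.sum_eq, mergedHZ, toricHZ, add_mul, Finset.sum_add_distrib, ite_and]

theorem mulVec_mergedHZ_vert (v : VZ) : (mergedHZ AZ AX *ᵥ x) (.vert v)
    = ∑ q, AZ.F q v * x (.orig q) + (∑ e, incidence GZ e v * x (.edgeZ e)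
      + ∑ j, AZ.P v j * x (.torZ 0 j)) := by
  simp [mulVec, dotProduct, Qubit.sum_eq, mergedHZ]

theorem mulVec_mergedHX_orig (s : SX) : (mergedHX AZ AX *ᵥ x) (.orig s)
    = ∑ q, C.HX s q * x (.orig q) + ∑ e, AZ.M s e * x (.edgeZ e) := by
  simp [mulVec, dotProduct, Qubit.sum_eq, mergedHX]

theorem mulVec_mergedHX_cyc (u : UZ) : (mergedHX AZ AX *ᵥ x) (.cyc u)
    = ∑ e, AZ.N u e * x (.edgeZ e) := by
  simp [mulVec, dotProduct, Qubit.sum_eq, mergedHX]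

theorem mulVec_mergedHX_tor (i j : ZMod m) : (mergedHX AZ AX *ᵥ x) (.tor i j)
    = (if i = 0 then ∑ e, AZ.T j e * x (.edgeZ e) else 0)
      + ((x (.torZ i j) + x (.torZ i (j + 1))) + (x (.torX i j) + x (.torX (i - 1) j))) := by
  have h := sum_cyclicCheck_mul (fun j' => x (.torZ i j')) j
  rw [← h]
  simp [mulVec, dotProduct, Qubit.sum_eq, mergedHX, toricHX, add_mul, Finset.sum_add_distrib, ite_and]

theorem mulVec_mergedHX_vert (v : VX) : (mergedHX AZ AX *ᵥ x) (.vert v)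
    = ∑ q, AX.F q v * x (.orig q) + (∑ e, incidence GX e v * x (.edgeX e)
      + ∑ j, AX.P v j * x (.torX (-1) j)) := by
  simp [mulVec, dotProduct, Qubit.sum_eq, mergedHX]

/-- The merged representative of an `X`-type logical operator: the operator `X(u)`, an operator on the
edges of the first auxiliary graph, and a power of the toric code logical operator `X̄^(1)`. -/
def logicalX {EZ : Type*} (EX : Type*) (m : ℕ) (u : Q → ZMod 2) (w : EZ → ZMod 2) (γ : ZMod 2) :
    Qubit Q EZ EX m → ZMod 2
  | .orig q => u q
  | .edgeZ e => w e
  | .torZ _ j => if j = 0 then γ else 0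
  | _ => 0

/-- The merged representative of a `Z`-type logical operator: the operator `Z(u)`, an operator on the
edges of the second auxiliary graph, and a power of the toric code logical operator `Z̄^(2)`. -/
def logicalZ (EZ : Type*) {EX : Type*} (m : ℕ) (u : Q → ZMod 2) (w : EX → ZMod 2) (γ : ZMod 2) :
    Qubit Q EZ EX m → ZMod 2
  | .orig q => u q
  | .edgeX e => w e
  | .torX _ j => if j = 0 then γ else 0
  | _ => 0

/-- The vertex checks violated by `X(u)` have parity `u ⬝ᵥ lz`. That many copies of the toric loop
add the same parity at the vertex labelled `0`, so the total is even and is the boundary of an edge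
set `w`. -/
theorem exists_logicalX {u : Q → ZMod 2} (hu : C.HZ *ᵥ u = 0) :
    ∃ w, mergedHZ AZ AX *ᵥ logicalX GX.edgeSet m u w (u ⬝ᵥ lz) = 0 := by
  have two : ∀ a : ZMod 2, a + a = 0 := by decide
  obtain ⟨w, hw⟩ := exists_vecMul_incidence AZ.connected
    (fun v => ∑ q, AZ.F q v * u q + AZ.P v 0 * (u ⬝ᵥ lz)) (by
      rw [Finset.sum_add_distrib, Finset.sum_comm, ← Finset.sum_mul, AZ.sum_P, one_mul]
      simp only [← Finset.sum_mul, AZ.sum_F]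
      rw [dotProduct_comm]
      exact two _)
  refine ⟨w, funext fun r => ?_⟩
  cases r with
  | orig s =>
    rw [mulVec_mergedHZ_orig]
    simpa [logicalX, mulVec, dotProduct] using congrFun hu s
  | cyc u => simp [mulVec_mergedHZ_cyc, logicalX]
  | tor i j => simp [mulVec_mergedHZ_tor, logicalX, two]
  | vert v =>
    have := congrFun hw v
    simp only [vecMul, dotProduct] at this
    simp only [mulVec_mergedHZ_vert, logicalX, mul_comm (incidence _ _ _), this, dotProduct]
    simp only [mul_ite, mul_zero, Finset.sum_ite_eq', Finset.mem_univ, if_true, Pi.zero_apply]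
    rw [add_assoc, two, add_zero, two]

theorem exists_logicalZ {u : Q → ZMod 2} (hu : C.HX *ᵥ u = 0) :
    ∃ w, mergedHX AZ AX *ᵥ logicalZ GZ.edgeSet m u w (u ⬝ᵥ lx) = 0 := by
  have two : ∀ a : ZMod 2, a + a = 0 := by decide
  obtain ⟨w, hw⟩ := exists_vecMul_incidence AX.connected
    (fun v => ∑ q, AX.F q v * u q + AX.P v 0 * (u ⬝ᵥ lx)) (by
      rw [Finset.sum_add_distrib, Finset.sum_comm, ← Finset.sum_mul, AX.sum_P, one_mul]
      simp only [← Finset.sum_mul, AX.sum_F]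
      rw [dotProduct_comm]
      exact two _)
  refine ⟨w, funext fun r => ?_⟩
  cases r with
  | orig s =>
    rw [mulVec_mergedHX_orig]
    simpa [logicalZ, mulVec, dotProduct] using congrFun hu s
  | cyc u => simp [mulVec_mergedHX_cyc, logicalZ]
  | tor i j => simp [mulVec_mergedHX_tor, logicalZ, two]
  | vert v =>
    have := congrFun hw v
    simp only [vecMul, dotProduct] at this
    simp only [mulVec_mergedHX_vert, logicalZ, mul_comm (incidence _ _ _), this, dotProduct]
    simp only [mul_ite, mul_zero, Finset.sum_ite_eq', Finset.mem_univ, if_true, Pi.zero_apply]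
    rw [add_assoc, two, add_zero, two]

/-! ### Completeness -/

/-- The span of the `X`-checks of the merged code. -/
abbrev mergedSpanX : Submodule (ZMod 2) (Qubit Q GZ.edgeSet GX.edgeSet m → ZMod 2) :=
  Submodule.span (ZMod 2) (Set.range (mergedHX AZ AX))

theorem mergedHX_mem (r : Check SX UZ VX m) : mergedHX AZ AX r ∈ mergedSpanX AZ AX :=
  Submodule.subset_span ⟨r, rfl⟩

theorem mem_mergedSpanX_of_cycle (w : GZ.edgeSet → ZMod 2)
    (hw : w ∈ Submodule.span (ZMod 2) (Set.range AZ.N)) :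
    logicalX GX.edgeSet m (0 : Q → ZMod 2) w 0 ∈ mergedSpanX AZ AX := by
  induction hw using Submodule.span_induction with
  | mem w hw =>
    obtain ⟨u, rfl⟩ := hw
    convert mergedHX_mem AZ AX (.cyc u) using 1
    funext y
    cases y <;> simp [logicalX, mergedHX]
  | zero =>
    convert Submodule.zero_mem _ using 1
    funext y
    cases y <;> simp [logicalX]
  | add a b _ _ ha hb =>
    convert add_mem ha hb using 1
    funext y
    cases y <;> simp [logicalX]
  | smul a b _ hb =>
    convert Submodule.smul_mem _ a hb using 1
    funext y
    cases y <;> simp [logicalX]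

/-- Each original check extends to a merged check by its matching edges, and extensions add up. -/
theorem exists_mem_mergedSpanX_of_check (u : Q → ZMod 2) (hu : u ∈ C.spanX) :
    ∃ w, logicalX GX.edgeSet m u w 0 ∈ mergedSpanX AZ AX := by
  induction hu using Submodule.span_induction with
  | mem u hu =>
    obtain ⟨s, rfl⟩ := hu
    refine ⟨AZ.M s, ?_⟩
    convert mergedHX_mem AZ AX (.orig s) using 1
    funext y
    cases y <;> simp [logicalX, mergedHX]
  | zero =>
    refine ⟨0, ?_⟩
    convert Submodule.zero_mem _ using 1
    funext y
    cases y <;> simp [logicalX]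
  | add a b _ _ ha hb =>
    obtain ⟨w, hw⟩ := ha
    obtain ⟨w', hw'⟩ := hb
    refine ⟨w + w', ?_⟩
    convert add_mem hw hw' using 1
    funext y
    cases y <;> simp [logicalX]
  | smul a b _ hb =>
    obtain ⟨w, hw⟩ := hb
    refine ⟨a • w, ?_⟩
    convert Submodule.smul_mem _ a hw using 1
    funext y
    cases y <;> simp [logicalX]

/-- The sum of vertex checks with coefficients `p`. -/
theorem sum_vert_mem (p : VX → ZMod 2) :
    ∑ v, p v • mergedHX AZ AX (.vert v) ∈ mergedSpanX AZ AX :=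
  Submodule.sum_mem _ fun _ _ => Submodule.smul_mem _ _ (mergedHX_mem AZ AX _)

/-- The sum of toric code checks with coefficients `f`. -/
def torSum (f : ZMod m → ZMod m → ZMod 2) : Qubit Q GZ.edgeSet GX.edgeSet m → ZMod 2 :=
  ∑ i, ∑ j, f i j • mergedHX AZ AX (.tor i j)

theorem torSum_mem (f : ZMod m → ZMod m → ZMod 2) : torSum AZ AX f ∈ mergedSpanX AZ AX :=
  Submodule.sum_mem _ fun _ _ => Submodule.sum_mem _ fun _ _ =>
    Submodule.smul_mem _ _ (mergedHX_mem AZ AX _)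

theorem torSum_edgeX (f : ZMod m → ZMod m → ZMod 2) (e : GX.edgeSet) :
    torSum AZ AX f (.edgeX e) = 0 := by
  simp [torSum, Finset.sum_apply, mergedHX, toricHX]

theorem torSum_torZ (f : ZMod m → ZMod m → ZMod 2) (i j : ZMod m) :
    torSum AZ AX f (.torZ i j) = f i j + f i (j - 1) := by
  rw [← sum_mul_cyclicCheck]
  simp [torSum, Finset.sum_apply, mergedHX, toricHX, Finset.sum_ite_irrel]

/-- On `Q^X` the toric checks act by differences between layers, on `Q^Z` by differences between
positions. Coefficients independent of the layer therefore leave `Q^X` alone. -/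
theorem torSum_torX (f : ZMod m → ZMod m → ZMod 2) (i j : ZMod m) :
    torSum AZ AX f (.torX i j) = f i j + f (i + 1) j := by
  have : ∀ i', (i = i' - 1) = (i' = i + 1) := fun i' => by
    rw [eq_sub_iff_add_eq, eq_comm (a := i + 1)]
  simp [torSum, Finset.sum_apply, mergedHX, toricHX, ite_and, mul_add, Finset.sum_add_distrib,
    Finset.sum_ite_irrel, this]

variable {AZ AX x}

/-- After the original part is removed by extended checks, only edges of `GZ` remain; commutation
with the vertex checks makes them a cycle. -/
theorem mem_of_edgeX_tor_eq_zero (hdisj : ∀ q, lz q = 0 ∨ lx q = 0)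
    (hx : mergedHZ AZ AX *ᵥ x = 0) (hX : ∀ e, x (.edgeX e) = 0)
    (htX : ∀ i j, x (.torX i j) = 0) (htZ : ∀ i j, x (.torZ i j) = 0)
    (hq : (fun q => x (.orig q)) ∈ C.spanX) : x ∈ mergedSpanX AZ AX := by
  obtain ⟨w, hw⟩ := exists_mem_mergedSpanX_of_check AZ AX _ hq
  rw [← Submodule.sub_mem_iff_left _ hw]
  have hw' : mergedHZ AZ AX *ᵥ (x - logicalX GX.edgeSet m (fun q => x (.orig q)) w 0) = 0 := by
    rw [mulVec_sub, hx, sub_eq_zero, eq_comm]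
    exact (mergedCode hdisj AZ AX).mulVec_HZ_of_mem_spanX hw
  convert mem_mergedSpanX_of_cycle AZ AX (fun e => x (.edgeZ e) - w e)
    ((AZ.cycles _).1 (funext fun v => ?_)) using 1
  · funext y
    cases y <;> simp [logicalX, hX, htX, htZ]
  · have := congrFun hw' (.vert v)
    rw [mulVec_mergedHZ_vert] at this
    simpa [logicalX, htZ, vecMul, dotProduct, mul_comm] using this

section

variable {ι : Type*} [Fintype ι] [DecidableEq ι] {LX LZ : ι → Q → ZMod 2}
  {w : ι → GZ.edgeSet → ZMod 2}

/-- The span of the `X`-checks and of the merged representatives. -/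
abbrev mergedSpanLogicalX (AZ : AuxGraph C.HX lz GZ UZ (cyclicCheck m))
    (AX : AuxGraph C.HZ lx GX UX (cyclicCheck m)ᵀ) (LX : ι → Q → ZMod 2)
    (w : ι → GZ.edgeSet → ZMod 2) :
    Submodule (ZMod 2) (Qubit Q GZ.edgeSet GX.edgeSet m → ZMod 2) :=
  mergedSpanX AZ AX ⊔
    Submodule.span (ZMod 2) (Set.range fun i => logicalX GX.edgeSet m (LX i) (w i) (LX i ⬝ᵥ lz))

theorem mem_of_torZ_eq (hdisj : ∀ q, lz q = 0 ∨ lx q = 0) (hL : C.IsLogicalBasis LX LZ)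
    (hw : ∀ i, mergedHZ AZ AX *ᵥ logicalX GX.edgeSet m (LX i) (w i) (LX i ⬝ᵥ lz) = 0)
    (hlz : C.HX *ᵥ lz = 0)
    (hx : mergedHZ AZ AX *ᵥ x = 0) (hX : ∀ e, x (.edgeX e) = 0) (htX : ∀ i j, x (.torX i j) = 0)
    (γ : ZMod 2) (htZ : ∀ i j, x (.torZ i j) = if j = 0 then γ else 0) :
    x ∈ mergedSpanLogicalX AZ AX LX w := by
  set u : Q → ZMod 2 := fun q => x (.orig q) with hu
  have hu0 : C.HZ *ᵥ u = 0 := by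
    funext s
    have := congrFun hx (.orig s)
    rw [mulVec_mergedHZ_orig] at this
    simpa [hX, mulVec, dotProduct] using this
  -- Sum all vertex checks of `GZ`: edges cancel, ports contribute `lz ⬝ᵥ u`, and the labels
  -- contribute the parity of layer `0`, which is `γ`.
  have hγ : lz ⬝ᵥ u + γ = 0 := by
    have : ∑ v, (mergedHZ AZ AX *ᵥ x) (.vert v) = 0 := by simp [hx]
    simp only [mulVec_mergedHZ_vert, Finset.sum_add_distrib, htZ] at this
    have h1 : ∑ v, ∑ q, AZ.F q v * x (.orig q) = lz ⬝ᵥ u := by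
      rw [Finset.sum_comm]
      simp only [← Finset.sum_mul, AZ.sum_F]
      rfl
    have h2 : ∑ v, ∑ e, incidence GZ e v * x (.edgeZ e) = 0 := by
      rw [Finset.sum_comm]
      simp only [← Finset.sum_mul, sum_incidence, zero_mul, Finset.sum_const_zero]
    rw [h1, h2, zero_add] at this
    simpa [← Finset.sum_mul, AZ.sum_P] using this
  obtain ⟨μ, hμ⟩ : ∃ μ : ι → ZMod 2, u - ∑ i, μ i • LX i ∈ C.spanX := by
    obtain ⟨a, ha, l, hl, e⟩ := Submodule.mem_sup.1 (hL.x_complete u hu0)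
    obtain ⟨μ, rfl⟩ := (Submodule.mem_span_range_iff_exists_fun _).1 hl
    exact ⟨μ, by rwa [← e, add_sub_cancel_right]⟩
  -- By `hγ` the merged representatives with coefficients `μ` carry exactly the toric loop present
  -- in `x`, so subtracting them also clears `Q^Z`.
  have hμz : ∑ i, μ i * (LX i ⬝ᵥ lz) = γ := by
    have h := C.dotProduct_spanX hμ hlz
    rw [sub_dotProduct, sum_dotProduct, sub_eq_zero] at h
    simp only [smul_dotProduct, smul_eq_mul] at h
    rw [← h, dotProduct_comm]
    exact (eq_neg_of_add_eq_zero_left hγ).trans (ZMod.neg_eq_self_mod_two _)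
  have hs : ∑ i, μ i • logicalX GX.edgeSet m (LX i) (w i) (LX i ⬝ᵥ lz)
      ∈ Submodule.span (ZMod 2)
        (Set.range fun i => logicalX GX.edgeSet m (LX i) (w i) (LX i ⬝ᵥ lz)) :=
    Submodule.sum_mem _ fun i _ => Submodule.smul_mem _ _ (Submodule.subset_span ⟨i, rfl⟩)
  rw [← sub_add_cancel x (∑ i, μ i • logicalX GX.edgeSet m (LX i) (w i) (LX i ⬝ᵥ lz))]
  refine Submodule.add_mem_sup (mem_of_edgeX_tor_eq_zero hdisj ?_ ?_ ?_ ?_ ?_) hs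
  · rw [mulVec_sub, hx, mulVec_sum]
    simp [mulVec_smul, hw]
  · simp [hX, logicalX, Finset.sum_apply]
  · simp [htX, logicalX, Finset.sum_apply]
  · intro i j
    by_cases hj : j = 0
    · simp [htZ, logicalX, Finset.sum_apply, hj, hμz]
    · simp [htZ, logicalX, Finset.sum_apply, hj]
  · convert hμ using 1
    funext q
    simp [logicalX, Finset.sum_apply, hu]

/-- With `Q^X` empty, the toric `Z`-checks force all layers of `Q^Z` to agree. The same checks
applied in every layer then push the pattern onto position `0`, leaving a multiple of the loop. -/
theorem mem_of_torX_eq_zero (hdisj : ∀ q, lz q = 0 ∨ lx q = 0) (hL : C.IsLogicalBasis LX LZ)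
    (hw : ∀ i, mergedHZ AZ AX *ᵥ logicalX GX.edgeSet m (LX i) (w i) (LX i ⬝ᵥ lz) = 0)
    (hlz : C.HX *ᵥ lz = 0)
    (hx : mergedHZ AZ AX *ᵥ x = 0) (hX : ∀ e, x (.edgeX e) = 0) (htX : ∀ i j, x (.torX i j) = 0) :
    x ∈ mergedSpanLogicalX AZ AX LX w := by
  have two : ∀ a : ZMod 2, a + a = 0 := by decide
  have hconst : ∀ i j, x (.torZ i j) = x (.torZ 0 j) := by
    intro i j
    refine eq_of_forall_add_one (fun i => x (.torZ i j)) (fun i => ?_) i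
    have := congrFun hx (.tor i j)
    rw [mulVec_mergedHZ_tor] at this
    simp only [hX, htX, mul_zero, Finset.sum_const_zero, ite_self, zero_add, add_zero,
      Pi.zero_apply] at this
    rw [eq_comm]
    exact (eq_neg_of_add_eq_zero_left this).trans (ZMod.neg_eq_self_mod_two _)
  obtain ⟨f, hf⟩ := exists_add_shift fun j => x (.torZ 0 (j + 1))
  have hs := torSum_mem AZ AX (fun _ j => f j)
  rw [← Submodule.sub_mem_iff_left _ (Submodule.mem_sup_left hs)]
  refine mem_of_torZ_eq hdisj hL hw hlz ?_ ?_ ?_ (x (.torZ 0 0) - (f 0 + f (-1))) ?_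
  · rw [mulVec_sub, hx, sub_eq_zero, eq_comm]
    exact (mergedCode hdisj AZ AX).mulVec_HZ_of_mem_spanX hs
  · simp [hX, torSum_edgeX]
  · intro i j
    rw [Pi.sub_apply, htX, torSum_torX, two, sub_zero]
  · intro i j
    rw [Pi.sub_apply, torSum_torZ, hconst]
    split_ifs with hj
    · simp [hj]
    · have := hf (j - 1) (by simpa using hj)
      rw [sub_add_cancel] at this
      rw [add_comm (f j), this, sub_self]

theorem mem_of_torX_last (hdisj : ∀ q, lz q = 0 ∨ lx q = 0) (hL : C.IsLogicalBasis LX LZ)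
    (hw : ∀ i, mergedHZ AZ AX *ᵥ logicalX GX.edgeSet m (LX i) (w i) (LX i ⬝ᵥ lz) = 0)
    (hlz : C.HX *ᵥ lz = 0)
    (hx : mergedHZ AZ AX *ᵥ x = 0) (hX : ∀ e, x (.edgeX e) = 0)
    (htX : ∀ i, i ≠ -1 → ∀ j, x (.torX i j) = 0) :
    x ∈ mergedSpanLogicalX AZ AX LX w := by
  have two : ∀ a : ZMod 2, a + a = 0 := by decide
  have hconst : ∀ j, x (.torX (-1) j) = x (.torX (-1) 0) := by
    refine eq_of_forall_add_one _ fun j => ?_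
    -- Summed over all layers, the `Q^Z` terms cancel in pairs and only two adjacent positions of
    -- the last `Q^X` layer survive.
    have h : ∑ i, (mergedHZ AZ AX *ᵥ x) (.tor i (j + 1)) = 0 := by simp [hx]
    simp only [mulVec_mergedHZ_tor, hX, mul_zero, Finset.sum_const_zero, ite_self, zero_add,
      Finset.sum_add_distrib, add_sub_cancel_right] at h
    rw [show ∑ i, x (.torZ (i + 1) (j + 1)) = ∑ i, x (.torZ i (j + 1)) from
      Equiv.sum_comp (Equiv.addRight (1 : ZMod m)) fun i => x (.torZ i (j + 1)), two, zero_add,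
      Finset.sum_eq_single (-1), Finset.sum_eq_single (-1)] at h
    · exact (eq_neg_of_add_eq_zero_left h).trans (ZMod.neg_eq_self_mod_two _)
    all_goals simp +contextual [htX]
  -- The product of all vertex checks of `GX` touches no edge and fills the layer `-1` of `Q^X`,
  -- since every label is used once.
  have hs := sum_vert_mem AZ AX (fun _ => x (.torX (-1) 0))
  rw [← Submodule.sub_mem_iff_left _ (Submodule.mem_sup_left hs)]
  refine mem_of_torX_eq_zero hdisj hL hw hlz ?_ ?_ ?_
  · rw [mulVec_sub, hx, sub_eq_zero, eq_comm]
    exact (mergedCode hdisj AZ AX).mulVec_HZ_of_mem_spanX hs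
  · intro e
    simp [Finset.sum_apply, hX, mergedHX, ← Finset.mul_sum, sum_incidence]
  · intro i j
    by_cases hi : i = -1
    · simp [Finset.sum_apply, hi, hconst j, mergedHX, toricHX, ← Finset.mul_sum, AX.sum_P]
    · simp [Finset.sum_apply, htX i hi, mergedHX, toricHX, hi]

theorem mem_of_edgeX_eq_zero (hdisj : ∀ q, lz q = 0 ∨ lx q = 0) (hL : C.IsLogicalBasis LX LZ)
    (hw : ∀ i, mergedHZ AZ AX *ᵥ logicalX GX.edgeSet m (LX i) (w i) (LX i ⬝ᵥ lz) = 0)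
    (hlz : C.HX *ᵥ lz = 0)
    (hx : mergedHZ AZ AX *ᵥ x = 0) (hX : ∀ e, x (.edgeX e) = 0) :
    x ∈ mergedSpanLogicalX AZ AX LX w := by
  choose f hf using fun j => exists_add_shift fun i => x (.torX i j)
  have hs := torSum_mem AZ AX (fun i j => f j i)
  rw [← Submodule.sub_mem_iff_left _ (Submodule.mem_sup_left hs)]
  refine mem_of_torX_last hdisj hL hw hlz ?_ ?_ ?_
  · rw [mulVec_sub, hx, sub_eq_zero, eq_comm]
    exact (mergedCode hdisj AZ AX).mulVec_HZ_of_mem_spanX hs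
  · simp [hX, torSum_edgeX]
  · intro i hi j
    rw [Pi.sub_apply, torSum_torX, hf j i hi, sub_self]

/-- The checks and the merged representatives generate all `X`-type operators that commute with the
checks of the merged code. -/
theorem merged_x_complete (hdisj : ∀ q, lz q = 0 ∨ lx q = 0) (hL : C.IsLogicalBasis LX LZ)
    (hw : ∀ i, mergedHZ AZ AX *ᵥ logicalX GX.edgeSet m (LX i) (w i) (LX i ⬝ᵥ lz) = 0)
    (hlz : C.HX *ᵥ lz = 0) (hx : mergedHZ AZ AX *ᵥ x = 0) :
    x ∈ mergedSpanLogicalX AZ AX LX w := by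
  obtain ⟨p, hp⟩ : ∃ p, (fun e => x (.edgeX e)) = incidence GX *ᵥ p := by
    refine AX.exists_incidence_mulVec (funext fun u => ?_)
    have := congrFun hx (.cyc u)
    rwa [mulVec_mergedHZ_cyc] at this
  have hs := sum_vert_mem AZ AX p
  rw [← Submodule.sub_mem_iff_left _ (Submodule.mem_sup_left hs)]
  refine mem_of_edgeX_eq_zero hdisj hL hw hlz ?_ fun e => ?_
  · rw [mulVec_sub, hx, sub_eq_zero, eq_comm]
    exact (mergedCode hdisj AZ AX).mulVec_HZ_of_mem_spanX hs
  · rw [Pi.sub_apply, show x (.edgeX e) = _ from congrFun hp e, sub_eq_zero]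
    simp [Finset.sum_apply, mergedHX, mulVec, dotProduct, mul_comm]

end

end MergedLogicals

/-! ### The circuit as a linear map of the computational basis -/

section Circuit

variable {Q EZ EX : Type*} {m : ℕ} [NeZero m]

/-- The action of the circuit on the computational basis. -/
def twist (Q EZ EX : Type*) (m : ℕ) :
    (Qubit Q EZ EX m → ZMod 2) ≃ₗ[ZMod 2] (Qubit Q EZ EX m → ZMod 2) where
  toFun s
    | .torZ i j => s (.torZ i (j + i))
    | .torX i j => s (.torX i (j + i + 1)) + s (.torZ i (j + i + 1))
    | y => s y
  invFun s
    | .torZ i j => s (.torZ i (j - i))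
    | .torX i j => s (.torX i (j - i - 1)) - s (.torZ i (j - i))
    | y => s y
  map_add' s s' := by
    funext y
    cases y <;> simp [add_add_add_comm]
  map_smul' a s := by
    funext y
    cases y <;> simp [mul_add]
  left_inv s := by
    funext y
    cases y with
    | torX i j =>
      have e : j - i - 1 + i + 1 = j := by ring
      simp [e]
    | _ => simp
  right_inv s := by
    funext y
    cases y with
    | torX i j =>
      have e : j + i + 1 - i - 1 = j := by ring
      simp [e]
    | _ => simp

/-- The first `n` CNOT gates of the transversal gate on layer `i`. -/
def partialCNOT (i : ZMod m) (n : ℕ) (s : Qubit Q EZ EX m → ZMod 2) : Qubit Q EZ EX m → ZMod 2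
  | .torX i' j => if i' = i ∧ j.val < n then s (.torX i' j) + s (.torZ i' j) else s (.torX i' j)
  | y => s y

/-- The first `n` layers of the circuit. -/
def partialTwist (n : ℕ) (s : Qubit Q EZ EX m → ZMod 2) : Qubit Q EZ EX m → ZMod 2
  | .torZ i j => if i.val < n then s (.torZ i (j + i)) else s (.torZ i j)
  | .torX i j => if i.val < n then s (.torX i (j + i + 1)) + s (.torZ i (j + i + 1))
      else s (.torX i j)
  | y => s y

theorem val_lt_succ_iff {n : ℕ} (hn : n < m) (j : ZMod m) :
    j.val < n + 1 ↔ j.val < n ∨ j = (n : ZMod m) := by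
  rw [Nat.lt_succ_iff_lt_or_eq]
  refine or_congr_right ⟨fun h => ?_, fun h => ?_⟩
  · rw [← h, ZMod.natCast_zmod_val]
  · rw [h, ZMod.val_natCast_of_lt hn]

variable [Fintype Q] [Fintype EZ] [Fintype EX] [DecidableEq Q] [DecidableEq EZ] [DecidableEq EX]

theorem prod_cnotGate (i : ZMod m) (n : ℕ) (hn : n ≤ m) :
    ((List.range n).map fun j : ℕ =>
      cnotGate (Qubit.torZ i (j : ZMod m)) (.torX i (j : ZMod m) : Qubit Q EZ EX m)).prod
      = basisMap (partialCNOT i n) := by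
  induction n with
  | zero =>
    rw [List.range_zero, List.map_nil, List.prod_nil, ← basisMap_id]
    congr 1
    funext s y
    cases y <;> simp [partialCNOT]
  | succ n ih =>
    rw [List.range_succ, List.map_append, List.prod_append, ih (by omega), List.map_singleton,
      List.prod_singleton]
    have hc : ∀ a b : Qubit Q EZ EX m,
        cnotGate a b = basisMap (fun s => Function.update s b (s b + s a)) := fun _ _ => rfl
    -- The appended factor is rightmost and so acts first; all controls lie in `Q^Z`, which no gate
    -- changes.
    rw [hc, basisMap_mul]
    congr 1
    funext s y
    cases y with
    | torX i' j =>
      have hv := ZMod.val_natCast_of_lt (n := m) (a := n) (by omega)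
      simp only [partialCNOT, Function.comp, val_lt_succ_iff (show n < m by omega)]
      by_cases h : i' = i
      · by_cases hj : j = (n : ZMod m)
        · simp [h, hj, hv]
        · simp [h, hj]
      · simp [h]
    | _ => simp [partialCNOT]

theorem transversalCNOT_eq (i : ZMod m) : transversalCNOT Q EZ EX i = basisMap (partialCNOT i m) :=
  prod_cnotGate i m le_rfl

theorem prod_layers (n : ℕ) (hn : n ≤ m) :
    ((List.range n).map fun i : ℕ =>
      permGate (Qubit.shiftZ (i : ZMod m) (-(i : ZMod m))) *
        permGate (Qubit.shiftX (i : ZMod m) (-(i : ZMod m) - 1)) *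
        transversalCNOT Q EZ EX (i : ZMod m)).prod = basisMap (partialTwist n) := by
  induction n with
  | zero =>
    rw [List.range_zero, List.map_nil, List.prod_nil, ← basisMap_id]
    congr 1
    funext s y
    cases y <;> simp [partialTwist]
  | succ n ih =>
    rw [List.range_succ, List.map_append, List.prod_append, ih (by omega), List.map_singleton,
      List.prod_singleton, transversalCNOT_eq]
    have hp : ∀ p : Equiv.Perm (Qubit Q EZ EX m), permGate p = basisMap (fun s => s ∘ p.symm) :=
      fun _ => rfl
    rw [hp, hp, basisMap_mul, basisMap_mul, basisMap_mul]
    congr 1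
    funext s y
    have hv := ZMod.val_natCast_of_lt (n := m) (a := n) (by omega)
    cases y with
    | torX i j =>
      simp only [partialTwist, Function.comp, val_lt_succ_iff (show n < m by omega),
        Qubit.shiftZ, Qubit.shiftX, Equiv.symm, Equiv.coe_fn_mk]
      by_cases hi : i = (n : ZMod m)
      · subst hi
        have e : j - (-(n : ZMod m) - 1) = j + n + 1 := by ring
        simp [hv, partialCNOT, ZMod.val_lt, e]
      · simp [hi, partialCNOT]
    | torZ i j =>
      simp only [partialTwist, Function.comp, val_lt_succ_iff (show n < m by omega),
        Qubit.shiftZ, Qubit.shiftX, Equiv.symm, Equiv.coe_fn_mk]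
      by_cases hi : i = (n : ZMod m)
      · subst hi
        simp [hv, partialCNOT]
      · simp [hi, partialCNOT]
    | _ => rfl

theorem dehnTwist_eq : dehnTwist Q EZ EX m = basisMap (twist Q EZ EX m) := by
  refine (prod_layers m le_rfl).trans ?_
  congr 1
  funext s y
  cases y <;> simp [partialTwist, ZMod.val_lt, twist]

end Circuit

/-! ### Stabilizers of the system before merging -/

section Initial

variable {SX SZ Q EZ EX : Type*} [Fintype Q] [Fintype EZ] [Fintype EX]
  [DecidableEq EZ] [DecidableEq EX] {m : ℕ} [NeZero m] {C : CSSCode SX SZ Q}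

omit [DecidableEq EZ] [DecidableEq EX] in
theorem toricHX_dotProduct_toricHZ (i j i' j' : ZMod m) :
    (toricHX EZ EX i j : Qubit Q EZ EX m → ZMod 2) ⬝ᵥ toricHZ EZ EX i' j' = 0 := by
  have two : ∀ a : ZMod 2, a + a = 0 := by decide
  have e1 : ∑ x, ∑ y, toricHX EZ EX (Q := Q) i j (.torZ x y)
      * toricHZ EZ EX (Q := Q) i' j' (.torZ x y)
      = (if i' = i then cyclicCheck m j j' else 0)
        + if i' + 1 = i then cyclicCheck m j j' else 0 := by
    simp [toricHX, toricHZ, mul_add, Finset.sum_add_distrib, ite_and]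
  have e2 : ∑ x, ∑ y, toricHX EZ EX (Q := Q) i j (.torX x y)
      * toricHZ EZ EX (Q := Q) i' j' (.torX x y)
      = (if i' = i then cyclicCheck m j j' else 0)
        + if i' = i - 1 then cyclicCheck m j j' else 0 := by
    simp [toricHX, toricHZ, add_mul, Finset.sum_add_distrib, ite_and]
  rw [dotProduct, Qubit.sum_eq, e1, e2]
  simp only [eq_sub_iff_add_eq]
  rw [two]
  simp [toricHX, toricHZ]

omit [DecidableEq EX] in
theorem dotProduct_eq_zero_of_mem_initialX {a z : Qubit Q EZ EX m → ZMod 2}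
    (ha : a ∈ initialX C EZ EX m) (h1 : ∀ s, embed EZ EX m (C.HX s) ⬝ᵥ z = 0)
    (h2 : ∀ e, z (.edgeZ e) = 0) (h3 : ∀ i j, toricHX EZ EX i j ⬝ᵥ z = 0)
    (h4 : toricX1 Q EZ EX m ⬝ᵥ z = 0) : a ⬝ᵥ z = 0 := by
  induction ha using Submodule.span_induction with
  | mem a ha =>
    rcases ha with ((⟨s, rfl⟩ | ⟨e, rfl⟩) | ⟨p, rfl⟩) | rfl
    · exact h1 s
    · simp [dotProduct, Qubit.sum_eq, h2]
    · exact h3 _ _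
    · exact h4
  | zero => simp
  | add a b _ _ ha hb => rw [add_dotProduct, ha, hb, add_zero]
  | smul a b _ hb => rw [smul_dotProduct, hb, smul_zero]

omit [DecidableEq EZ] in
theorem dotProduct_eq_zero_of_mem_initialZ {b x : Qubit Q EZ EX m → ZMod 2}
    (hb : b ∈ initialZ C EZ EX m) (h1 : ∀ s, x ⬝ᵥ embed EZ EX m (C.HZ s) = 0)
    (h2 : ∀ e, x (.edgeX e) = 0) (h3 : ∀ i j, x ⬝ᵥ toricHZ EZ EX i j = 0)
    (h4 : x ⬝ᵥ toricZ2 Q EZ EX m = 0) : x ⬝ᵥ b = 0 := by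
  induction hb using Submodule.span_induction with
  | mem b hb =>
    rcases hb with ((⟨s, rfl⟩ | ⟨e, rfl⟩) | ⟨p, rfl⟩) | rfl
    · exact h1 s
    · simp [dotProduct, Qubit.sum_eq, h2]
    · exact h3 _ _
    · exact h4
  | zero => simp
  | add a b _ _ ha hb => rw [dotProduct_add, ha, hb, add_zero]
  | smul a b _ hb => rw [dotProduct_smul, hb, smul_zero]

omit [DecidableEq EZ] [DecidableEq EX] in
theorem embed_dotProduct_embed (u v : Q → ZMod 2) :
    embed EZ EX m u ⬝ᵥ embed EZ EX m v = u ⬝ᵥ v := by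
  simp [dotProduct, Qubit.sum_eq, embed]

/-- Checked on generators: the prepared edge qubits are disjoint from the opposite type, toric
checks commute, and each toric loop meets every opposite toric check evenly and misses the other
loop. -/
theorem initial_dotProduct {a b : Qubit Q EZ EX m → ZMod 2}
    (ha : a ∈ initialX C EZ EX m) (hb : b ∈ initialZ C EZ EX m) : a ⬝ᵥ b = 0 := by
  have two : ∀ a : ZMod 2, a + a = 0 := by decide
  refine dotProduct_eq_zero_of_mem_initialZ hb (fun s => ?_) (fun e => ?_) (fun i j => ?_) ?_
  · refine dotProduct_eq_zero_of_mem_initialX ha (fun r => ?_) (fun e => rfl) (fun i j => ?_) ?_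
    · rw [embed_dotProduct_embed]
      exact congrFun (congrFun C.comm r) s
    · simp [dotProduct, Qubit.sum_eq, embed, toricHX]
    · simp [dotProduct, Qubit.sum_eq, embed, toricX1]
  · classical
    rw [← dotProduct_single_one a]
    refine dotProduct_eq_zero_of_mem_initialX ha (fun r => ?_) (fun e => ?_) (fun i j => ?_) ?_ <;>
      simp [embed, toricHX, toricX1]
  · refine dotProduct_eq_zero_of_mem_initialX ha (fun r => ?_) (fun e => rfl)
      (fun i' j' => toricHX_dotProduct_toricHZ _ _ _ _) ?_
    · simp [dotProduct, Qubit.sum_eq, embed, toricHZ]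
    · simp [dotProduct, Qubit.sum_eq, toricX1, toricHZ, mul_add, Finset.sum_add_distrib, ite_and,
        two]
  · refine dotProduct_eq_zero_of_mem_initialX ha (fun r => ?_) (fun e => rfl) (fun i j => ?_) ?_
    · simp [dotProduct, Qubit.sum_eq, embed, toricZ2]
    · simp [dotProduct, Qubit.sum_eq, toricHX, toricZ2, Finset.sum_add_distrib, ite_and,
        two]
    · simp [dotProduct, Qubit.sum_eq, toricX1, toricZ2]

/-- Merged representatives have the same commutation relations as the original operators. -/
theorem represents_dotProduct {RX RZ : Type*} {D : CSSCode RX RZ (Qubit Q EZ EX m)}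
    {u v : Q → ZMod 2} {x z : Qubit Q EZ EX m → ZMod 2} (hu : C.HZ *ᵥ u = 0) (hv : C.HX *ᵥ v = 0)
    (hx : RepresentsX C D u x) (hz : RepresentsZ C D v z) : x ⬝ᵥ z = u ⬝ᵥ v := by
  obtain ⟨a, ha, rfl⟩ : ∃ a ∈ initialX C EZ EX m, x = embed EZ EX m u + a :=
    ⟨_, hx.2, by rw [add_sub_cancel]⟩
  obtain ⟨b, hb, rfl⟩ : ∃ b ∈ initialZ C EZ EX m, z = embed EZ EX m v + b :=
    ⟨_, hz.2, by rw [add_sub_cancel]⟩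
  have h1 : a ⬝ᵥ embed EZ EX m v = 0 := by
    refine dotProduct_eq_zero_of_mem_initialX ha (fun r => ?_) (fun e => rfl) (fun i j => ?_) ?_
    · rw [embed_dotProduct_embed]
      exact congrFun hv r
    · simp [dotProduct, Qubit.sum_eq, embed, toricHX]
    · simp [dotProduct, Qubit.sum_eq, embed, toricX1]
  have h2 : embed EZ EX m u ⬝ᵥ b = 0 := by
    refine dotProduct_eq_zero_of_mem_initialZ hb (fun r => ?_) (fun e => rfl) (fun i j => ?_) ?_
    · rw [embed_dotProduct_embed, dotProduct_comm]
      exact congrFun hu r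
    · simp [dotProduct, Qubit.sum_eq, embed, toricHZ]
    · simp [dotProduct, Qubit.sum_eq, embed, toricZ2]
  rw [add_dotProduct, dotProduct_add, dotProduct_add, h1, h2, initial_dotProduct ha hb,
    embed_dotProduct_embed, add_zero, add_zero, add_zero]

omit [Fintype EX] [DecidableEq EX] [NeZero m] in
theorem logicalX_sub_embed_mem (u : Q → ZMod 2) (w : EZ → ZMod 2) (γ : ZMod 2) :
    logicalX EX m u w γ - embed EZ EX m u ∈ initialX C EZ EX m := by
  have : logicalX EX m u w γ - embed EZ EX m u
      = ∑ e, w e • (fun (e : EZ) (x : Qubit Q EZ EX m) =>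
        match x with
        | .edgeZ e' => if e' = e then (1 : ZMod 2) else 0
        | _ => 0) e + γ • toricX1 Q EZ EX m := by
    funext y
    cases y <;> simp [logicalX, embed, Finset.sum_apply, toricX1]
  rw [this]
  refine add_mem (Submodule.sum_mem _ fun e _ => Submodule.smul_mem _ _ (Submodule.subset_span
    (.inl (.inl (.inr ⟨e, rfl⟩))))) (Submodule.smul_mem _ _ (Submodule.subset_span (.inr rfl)))

omit [Fintype EZ] [DecidableEq EZ] [NeZero m] in
theorem logicalZ_sub_embed_mem (u : Q → ZMod 2) (w : EX → ZMod 2) (γ : ZMod 2) :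
    logicalZ EZ m u w γ - embed EZ EX m u ∈ initialZ C EZ EX m := by
  have : logicalZ EZ m u w γ - embed EZ EX m u
      = ∑ e, w e • (fun (e : EX) (x : Qubit Q EZ EX m) =>
        match x with
        | .edgeX e' => if e' = e then (1 : ZMod 2) else 0
        | _ => 0) e + γ • toricZ2 Q EZ EX m := by
    funext y
    cases y <;> simp [logicalZ, embed, Finset.sum_apply, toricZ2]
  rw [this]
  refine add_mem (Submodule.sum_mem _ fun e _ => Submodule.smul_mem _ _ (Submodule.subset_span
    (.inl (.inl (.inr ⟨e, rfl⟩))))) (Submodule.smul_mem _ _ (Submodule.subset_span (.inr rfl)))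

omit [DecidableEq EZ] [DecidableEq EX] in
-- The image of the loop has its `Q^X_i` part at the position `j` with `j + i + 1 = 0`, which is
-- position `0` only for `i = -1`: one intersection.
theorem twist_logicalX_dotProduct_logicalZ (u v : Q → ZMod 2) (w : EZ → ZMod 2) (w' : EX → ZMod 2)
    (γ γ' : ZMod 2) :
    twist Q EZ EX m (logicalX EX m u w γ) ⬝ᵥ logicalZ EZ m v w' γ' = u ⬝ᵥ v + γ * γ' := by
  simp [dotProduct, Qubit.sum_eq, twist, logicalX, logicalZ, ← eq_neg_iff_add_eq_zero]

end Initial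

/-! ### The circuit on the merged code -/

section MergedCircuit

variable {SX SZ Q VZ UZ VX UX : Type*} [Fintype Q]
  [Fintype VZ] [DecidableEq VZ] [Fintype VX] [DecidableEq VX]
  {m : ℕ} [NeZero m] {C : CSSCode SX SZ Q} {lz lx : Q → ZMod 2}
  {GZ : SimpleGraph VZ} [DecidableRel GZ.Adj] {GX : SimpleGraph VX} [DecidableRel GX.Adj]
  (AZ : AuxGraph C.HX lz GZ UZ (cyclicCheck m)) (AX : AuxGraph C.HZ lx GX UX (cyclicCheck m)ᵀ)

omit [NeZero m] in
theorem cyclicCheck_add (j j' i : ZMod m) :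
    cyclicCheck m j (j' + i) = cyclicCheck m (j - i) j' := by
  have e : j - i + 1 = j + 1 - i := by ring
  simp [cyclicCheck, shiftMatrix, Matrix.one_apply, sub_eq_iff_eq_add, eq_sub_iff_add_eq, e]

theorem twist_mergedHX (r : Check SX UZ VX m) :
    twist Q GZ.edgeSet GX.edgeSet m (mergedHX AZ AX r) ∈ mergedSpanX AZ AX := by
  have two : ∀ a : ZMod 2, a + a = 0 := by decide
  cases r with
  | tor i j =>
    convert mergedHX_mem AZ AX (.tor i (j - i)) using 1
    funext y
    cases y with
    | edgeZ e =>
      by_cases h : i = 0 <;> simp [twist, mergedHX, h]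
    | torZ i' j' =>
      by_cases h : i' = i
      · simp [twist, mergedHX, toricHX, h, cyclicCheck_add]
      · simp [twist, mergedHX, toricHX, h]
    | torX i' j' =>
      have e1 : (i' = i - 1 ∧ j' + i' + 1 = j) ↔ (i' = i - 1 ∧ j' = j - i) := by
        refine and_congr_right fun h => ?_
        rw [h, eq_sub_iff_add_eq, show j' + (i - 1) + 1 = j' + i by ring]
      -- The CNOTs copy the row of `H_C = I + C` onto `Q^X_i`. Its `I` part cancels the check's own
      -- qubit and the `C` part survives, one position further on.
      have e2 : (if i' = i ∧ j' + i' + 1 = j then 1 else 0)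
          + (if i' = i then cyclicCheck m j (j' + i' + 1) else 0)
          = if i' = i ∧ j' = j - i then 1 else 0 := by
        by_cases h : i' = i
        · subst h
          simp only [true_and, if_true, cyclicCheck, shiftMatrix, Matrix.add_apply,
            Matrix.one_apply, Matrix.of_apply, add_left_inj, eq_sub_iff_add_eq,
            eq_comm (a := j)]
          rw [← add_assoc, two, zero_add]
        · simp [h]
      simp only [twist, mergedHX, toricHX, LinearEquiv.coe_mk, LinearMap.coe_mk, AddHom.coe_mk,
        Matrix.of_apply, e1]
      rw [← e2, add_right_comm]
    | _ => simp [twist, mergedHX, toricHX]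
  | orig s =>
    convert mergedHX_mem AZ AX (.orig s) using 1
    funext y
    cases y <;> simp [twist, mergedHX]
  | cyc u =>
    convert mergedHX_mem AZ AX (.cyc u) using 1
    funext y
    cases y <;> simp [twist, mergedHX]
  | vert v =>
    convert mergedHX_mem AZ AX (.vert v) using 1
    funext y
    cases y with
    | torX i j =>
      by_cases h : i = -1 <;> simp [twist, mergedHX, h]
    | _ => simp [twist, mergedHX]

/-- The toric syndrome of the image at `(i, j)` is that of `x` at `(i, j + i + 1)`; all other
syndromes are unchanged. In the layer `i = -1`, where `T` acts, the index does not move. -/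
theorem mergedHZ_twist {x : Qubit Q GZ.edgeSet GX.edgeSet m → ZMod 2}
    (hx : mergedHZ AZ AX *ᵥ x = 0) :
    mergedHZ AZ AX *ᵥ twist Q GZ.edgeSet GX.edgeSet m x = 0 := by
  have two : ∀ a : ZMod 2, a + a = 0 := by decide
  funext r
  cases r with
  | tor i j =>
    have := congrFun hx (.tor i (j + i + 1))
    rw [mulVec_mergedHZ_tor, Pi.zero_apply] at this ⊢
    refine Eq.trans ?_ this
    have e : (if i = -1 then ∑ e, AX.T j e * x (.edgeX e) else 0)
        = if i = -1 then ∑ e, AX.T (j + i + 1) e * x (.edgeX e) else 0 := by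
      split_ifs with h
      · rw [h, neg_add_cancel_right]
      · rfl
    rw [← e]
    have e1 : j - 1 + i + 1 = j + i := by ring
    have e2 : j + (i + 1) = j + i + 1 := by ring
    change (if i = -1 then ∑ e, AX.T j e * x (.edgeX e) else 0)
      + ((x (.torZ i (j + i)) + x (.torZ (i + 1) (j + (i + 1))))
        + ((x (.torX i (j + i + 1)) + x (.torZ i (j + i + 1)))
          + (x (.torX i (j - 1 + i + 1)) + x (.torZ i (j - 1 + i + 1))))) = _
    rw [e1, e2, add_sub_cancel_right]
    have h2 := two (x (.torZ i (j + i)))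
    generalize (if i = -1 then ∑ e, AX.T j e * x (.edgeX e) else 0) = a
    linear_combination h2
  | orig s =>
    have := congrFun hx (.orig s)
    rw [mulVec_mergedHZ_orig] at this ⊢
    exact this
  | cyc u =>
    have := congrFun hx (.cyc u)
    rw [mulVec_mergedHZ_cyc] at this ⊢
    exact this
  | vert v =>
    have := congrFun hx (.vert v)
    rw [mulVec_mergedHZ_vert] at this ⊢
    simpa [twist] using this

end MergedCircuit

end ToricAdapter

/-! ### Assembly: logical basis and action of the circuit -/

theorem mainTheorem11 {Q SX SZ VZ UZ VX UX : Type*} [Fintype Q] [DecidableEq Q]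
    [Fintype VZ] [DecidableEq VZ] [Fintype VX] [DecidableEq VX] {m k : ℕ} [NeZero m]
    (C : ToricAdapter.CSSCode SX SZ Q) (LX LZ : Fin k → Q → ZMod 2) (hL : C.IsLogicalBasis LX LZ)
    (c t : Fin k) (hct : c ≠ t) (hdisj : ∀ q, LZ c q = 0 ∨ LX t q = 0)
    (GZ : SimpleGraph VZ) [DecidableRel GZ.Adj] (GX : SimpleGraph VX) [DecidableRel GX.Adj]
    (AZ : ToricAdapter.AuxGraph C.HX (LZ c) GZ UZ (ToricAdapter.cyclicCheck m))
    (AX : ToricAdapter.AuxGraph C.HZ (LX t) GX UX (ToricAdapter.cyclicCheck m).transpose) :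
    (∀ i, ∃ x, ToricAdapter.RepresentsX C (ToricAdapter.mergedCode hdisj AZ AX) (LX i) x) ∧
    (∀ i, ∃ z, ToricAdapter.RepresentsZ C (ToricAdapter.mergedCode hdisj AZ AX) (LZ i) z) ∧
    ∀ LX' LZ' : Fin k → ToricAdapter.Qubit Q GZ.edgeSet GX.edgeSet m → ZMod 2,
      (∀ i, ToricAdapter.RepresentsX C (ToricAdapter.mergedCode hdisj AZ AX) (LX i) (LX' i)) →
      (∀ i, ToricAdapter.RepresentsZ C (ToricAdapter.mergedCode hdisj AZ AX) (LZ i) (LZ' i)) →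
      (ToricAdapter.mergedCode hdisj AZ AX).IsLogicalBasis LX' LZ' ∧
      (ToricAdapter.mergedCode hdisj AZ AX).ImplementsLogicalCNOT LX' LZ' c t
        (ToricAdapter.dehnTwist Q GZ.edgeSet GX.edgeSet m) := by
  open ToricAdapter Matrix in
  choose w hw using fun i => exists_logicalX AZ AX (hL.x_comm i)
  choose w' hw' using fun i => exists_logicalZ AZ AX (hL.z_comm i)
  set D := mergedCode hdisj AZ AX
  set X := fun i => logicalX GX.edgeSet m (LX i) (w i) (LX i ⬝ᵥ LZ c) with hX
  set Z := fun i => logicalZ GZ.edgeSet m (LZ i) (w' i) (LZ i ⬝ᵥ LX t) with hZ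
  have hXr : ∀ i, RepresentsX C D (LX i) (X i) := fun i => ⟨hw i, logicalX_sub_embed_mem _ _ _⟩
  have hZr : ∀ i, RepresentsZ C D (LZ i) (Z i) := fun i => ⟨hw' i, logicalZ_sub_embed_mem _ _ _⟩
  have hpair : ∀ i j x z, RepresentsX C D (LX i) x → RepresentsZ C D (LZ j) z →
      x ⬝ᵥ z = if i = j then 1 else 0 := fun i j x z hx hz => by
    rw [represents_dotProduct (hL.x_comm i) (hL.z_comm j) hx hz, hL.pairing]
  have hXZ : D.IsLogicalBasis X Z := .of_x_complete (fun i => (hXr i).1) (fun i => (hZr i).1)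
    (fun i j => hpair i j _ _ (hXr i) (hZr j))
    fun x hx => merged_x_complete hdisj hL hw (hL.z_comm c) hx
  refine ⟨fun i => ⟨_, hXr i⟩, fun i => ⟨_, hZr i⟩, fun LX' LZ' hLX hLZ => ?_⟩
  have hL' : D.IsLogicalBasis LX' LZ' := hXZ.congr (fun i => (hLX i).1) (fun i => (hLZ i).1)
    (fun i j => hpair i j _ _ (hLX i) (hLZ j)) (fun i j => hpair i j _ _ (hLX i) (hZr j))
  refine ⟨hL', ?_⟩
  rw [dehnTwist_eq]
  have htwist : ∀ r, twist Q GZ.edgeSet GX.edgeSet m (D.HX r) ∈ D.spanX := twist_mergedHX AZ AX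
  refine CSSCode.implementsLogicalCNOT_basisMap hL' hct _ htwist fun s hs => ?_
  -- By completeness it suffices to compare pairings with the explicit representatives `Z j`, even
  -- though the given families are arbitrary.
  refine D.mem_spanX_of_pairing hXZ.z_comm hXZ.pairing (hXZ.x_complete _ ?_) fun j => ?_
  · rw [mulVec_sub, mulVec_add, mulVec_smul, hs, (hLX t).1, smul_zero, add_zero, sub_zero]
    exact mergedHZ_twist AZ AX hs
  · obtain ⟨a, ha, l, hl, rfl⟩ := Submodule.mem_sup.1 (hXZ.x_complete s hs)
    obtain ⟨μ, rfl⟩ := (Submodule.mem_span_range_iff_exists_fun _).1 hl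
    have h0 : LZ' c ⬝ᵥ (a + ∑ i, μ i • X i) = μ c := by
      rw [dotProduct_comm, add_dotProduct, D.dotProduct_spanX ha (hLZ c).1, zero_add,
        sum_dotProduct]
      simp only [smul_dotProduct, hpair _ c _ _ (hXr _) (hLZ c)]
      simp
    have h1 : (a + ∑ i, μ i • X i) ⬝ᵥ Z j = μ j := by
      rw [add_dotProduct, D.dotProduct_spanX ha (hZr j).1, zero_add, sum_dotProduct]
      simp only [smul_dotProduct, hpair _ j _ _ (hXr _) (hZr j)]
      simp
    have h2 : twist Q GZ.edgeSet GX.edgeSet m a ⬝ᵥ Z j = 0 :=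
      D.dotProduct_spanX (CSSCode.map_mem_spanX htwist ha) (hZr j).1
    -- The loop multiplicities are `LX i ⬝ᵥ LZ c` and `LZ j ⬝ᵥ LX t`, so the extra intersection
    -- occurs only for `i = c` and `j = t`.
    have h3 : ∀ i, twist Q GZ.edgeSet GX.edgeSet m (X i) ⬝ᵥ Z j
        = (if i = j then 1 else 0) + (if i = c then 1 else 0) * (if t = j then 1 else 0) := by
      intro i
      rw [hX, hZ, twist_logicalX_dotProduct_logicalZ, hL.pairing, hL.pairing,
        dotProduct_comm (LZ j), hL.pairing]
    rw [h0, sub_dotProduct, add_dotProduct, h1, smul_dotProduct, hpair t j _ _ (hLX t) (hZr j),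
      map_add, add_dotProduct, h2, map_sum, sum_dotProduct]
    simp only [map_smul, smul_dotProduct, h3]
    simp [mul_add, Finset.sum_add_distrib]
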